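/- Consider public-coin protocols in the shuffle model. A public random string $\alpha$ is sampled from a (discrete) distribution; each of the $n$ users applies the same randomizer $R_\alpha$, with independent private randomness, to their input $x_i$ and thereby produces a finite sequence of messages; all messages are concatenated and permuted uniformly at random; and an analyzer, given $\alpha$ and the shuffled messages, outputs a (random) real number. The protocol is *single-message* if every user always sends at most one message. It is *$(\epsilon,\delta)$-shuffle DP on $n$ users* if the map from datasets $(x_1,\dots,x_n)$ to the pair consisting of $\alpha$ and the shuffled messages is $(\epsilon,\delta)$-differentially private, where two datasets are neighboring if they differ, up to reordering, in one user's input. It *solves $\mathrm{CountDistinct}_{n,D}$ with error $e$* if, for every dataset of $n$ users with inputs from a universe of size $D$, its output is within $e$ of the number of distinct elements of the dataset with probability at least $0.99$. Theorem 4. For every function $\epsilon=\epsilon(n)\ge 0$ with $\epsilon = O(1)$ there are functions $\delta=\delta(n)\in(0,1]$ with $\delta = 2^{-\Theta(\log^8 n)}$ and $D = D(n)\in\mathbb{N}$ with $D=\Theta(n/\log^4 n)$ such that no public-coin single-message $(\epsilon,\delta)$-shuffle DP protocol on $n$ users solves $\mathrm{CountDistinct}_{n,D}$ with error $o(D)$.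 That is, for every function $e = e(n)$ with $e=o(D)$ and every sufficiently large $n$ (depending on $e$), there is no public-coin single-message $(\epsilon(n),\delta(n))$-shuffle DP protocol on $n$ users that solves $\mathrm{CountDistinct}_{n,D(n)}$ with error $e(n)$. -/

import Mathlib

open Filter Asymptotics

noncomputable section

/-- Two datasets of `n` users are neighboring if, up to reordering the users, they differ in the
input of (at most) one user. -/
def Neighboring {n : ℕ} {𝒳 : Type*} (X X' : Fin n → 𝒳) : Prop :=
  ∃ (σ : Equiv.Perm (Fin n)) (i : Fin n), ∀ j, j ≠ i → X' j = X (σ j)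

/-- `(ε, δ)`-differential privacy of a randomized algorithm on datasets of `n` users. -/
def IsDP {n : ℕ} {𝒳 𝒵 : Type*} (ε δ : ℝ) (P : (Fin n → 𝒳) → PMF 𝒵) : Prop :=
  ∀ X X' : Fin n → 𝒳, Neighboring X X' → ∀ S : Set 𝒵,
    (P X).toOuterMeasure S ≤
      ENNReal.ofReal (Real.exp ε) * (P X').toOuterMeasure S + ENNReal.ofReal δ

/-- The concatenation of the message sequences of users who independently apply the same local
randomizer `R` to their inputs. -/
def concatMessages {𝒳 Msg : Type*} (R : 𝒳 → PMF (List Msg)) : List 𝒳 → PMF (List Msg)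
  | [] => PMF.pure []
  | x :: xs => (R x).bind fun y => (concatMessages R xs).map fun ys => y ++ ys

/-- The shuffler: a uniformly random permutation of a sequence of messages. -/
def shuffler {Msg : Type*} (l : List Msg) : PMF (List Msg) :=
  (PMF.uniformOfFintype (Equiv.Perm (Fin l.length))).map fun σ =>
    List.ofFn fun i => l.get (σ i)

/-- A public-coin protocol in the shuffle model with inputs in `𝒳`, public random strings in `Coin`
and messages in `Msg`. All users apply the same local randomizer, which, like the analyzer,
sees the public random string. -/
structure ShuffleProtocol (Coin Msg 𝒳 : Type*) where
  /-- The distribution of the public random string. -/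
  pub : PMF Coin
  /-- The local randomizer. -/
  randomizer : Coin → 𝒳 → PMF (List Msg)
  /-- The (randomized) analyzer. -/
  analyzer : Coin → List Msg → PMF ℝ

namespace ShuffleProtocol

variable {Coin Msg 𝒳 : Type*}

/-- Every user always sends at most `k` messages. -/
def SendsAtMost (P : ShuffleProtocol Coin Msg 𝒳) (k : ℕ) : Prop :=
  ∀ a ∈ P.pub.support, ∀ x, ∀ l ∈ (P.randomizer a x).support, l.length ≤ k

/-- What the analyzer sees: the public random string and the shuffled messages. -/
def view (P : ShuffleProtocol Coin Msg 𝒳) {n : ℕ} (X : Fin n → 𝒳) : PMF (Coin × List Msg) :=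
  P.pub.bind fun a =>
    ((concatMessages (P.randomizer a) (List.ofFn X)).bind shuffler).map fun l => (a, l)

/-- The output of the protocol on a dataset. -/
def output (P : ShuffleProtocol Coin Msg 𝒳) {n : ℕ} (X : Fin n → 𝒳) : PMF ℝ :=
  (P.view X).bind fun v => P.analyzer v.1 v.2

/-- `P` is `(ε, δ)`-differentially private in the public-coin shuffle model with `n` users. -/
def IsShuffleDP (P : ShuffleProtocol Coin Msg 𝒳) (n : ℕ) (ε δ : ℝ) : Prop :=
  IsDP ε δ fun X : Fin n → 𝒳 => P.view X

end ShuffleProtocol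

/-- The number of distinct elements of a dataset. -/
def countDistinct {n D : ℕ} (X : Fin n → Fin D) : ℕ :=
  (Finset.univ.image X).card

/-- `P` solves the problem of counting distinct elements with `n` users and inputs from a universe
of size `D` with error `e`: on every dataset, the error is at most `e` with probability at least
`0.99`. -/
def ShuffleProtocol.SolvesCountDistinct {Coin Msg : Type*} {D : ℕ}
    (P : ShuffleProtocol Coin Msg (Fin D)) (n : ℕ) (e : ℝ) : Prop :=
  ∀ X : Fin n → Fin D,
    ENNReal.ofReal 0.99 ≤
      (P.output X).toOuterMeasure {z | |z - (countDistinct X : ℝ)| ≤ e}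

end

/-! Give every element `x` of the universe an intensity, drawn independently from one of two
distributions `u` and `v` on the nodes `8 * i ^ 4 / n`, `i ≤ κ`, which agree on all moments of
order less than `κ`, and let every user hold `x` with probability its intensity and a fixed
element `x₀` otherwise. Since `u` puts a constant mass on `0` and `v` none, a constant fraction
of the universe is missing from the dataset under `u` and almost nothing under `v`, so that an
accurate protocol tells the two distributions apart.

Privacy prevents this. If the single message of a user with input `x` had some outcomes much
likelier than under `x₀`, the event that many users send such an outcome would be unlikely for
the dataset constantly `x₀`, but too likely after one user changes to `x` for so small a `δ`.
Hence the randomizer on `x` is dominated, up to a tiny error, by a moderate multiple of the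
randomizer on `x₀`. The likelihood ratio of the messages with respect to users who all hold `x₀`
is then a polynomial in the intensities, whose terms of degree less than `κ` do not distinguish
`u` from `v`, and domination bounds the second moment of the remaining terms. -/

section ProductExpectation

variable {ι β : Type*} [Fintype ι] [DecidableEq ι] [Fintype β]

/-- The expectation of `f y` when the coordinates `y j` are independent with densities `r j`. The
densities are arbitrary real functions, so that the same operator also integrates against signed
and sub-probability weights. -/
noncomputable def prodExpect (r : ι → β → ℝ) (f : (ι → β) → ℝ) : ℝ :=
  ∑ y : ι → β, (∏ j, r j (y j)) * f y

theorem prodExpect_prod (r f : ι → β → ℝ) :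
    prodExpect r (fun y => ∏ j, f j (y j)) = ∏ j, ∑ z, r j z * f j z := by
  rw [Finset.prod_univ_sum, Fintype.piFinset_univ]
  simp only [prodExpect, Finset.prod_mul_distrib]

theorem prodExpect_const {r : ι → β → ℝ} (hr : ∀ j, ∑ z, r j z = 1) (c : ℝ) :
    prodExpect r (fun _ => c) = c := by
  have h := prodExpect_prod r fun _ _ => 1
  simp only [Finset.prod_const_one, mul_one, hr, prodExpect] at h
  rw [prodExpect, ← Finset.sum_mul, h, one_mul]

theorem prodExpect_add (r : ι → β → ℝ) (f g : (ι → β) → ℝ) :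
    prodExpect r (fun y => f y + g y) = prodExpect r f + prodExpect r g := by
  simp only [prodExpect, mul_add, Finset.sum_add_distrib]

theorem prodExpect_sub (r : ι → β → ℝ) (f g : (ι → β) → ℝ) :
    prodExpect r (fun y => f y - g y) = prodExpect r f - prodExpect r g := by
  simp only [prodExpect, mul_sub, Finset.sum_sub_distrib]

theorem prodExpect_sum {κ : Type*} (s : Finset κ) (r : ι → β → ℝ) (f : κ → (ι → β) → ℝ) :
    prodExpect r (fun y => ∑ k ∈ s, f k y) = ∑ k ∈ s, prodExpect r (f k) := by
  simp only [prodExpect, Finset.mul_sum]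
  exact Finset.sum_comm

theorem prodExpect_mono {r : ι → β → ℝ} (hr : ∀ j z, 0 ≤ r j z) {f g : (ι → β) → ℝ}
    (h : ∀ y, f y ≤ g y) : prodExpect r f ≤ prodExpect r g :=
  Finset.sum_le_sum fun y _ =>
    mul_le_mul_of_nonneg_left (h y) (Finset.prod_nonneg fun j _ => hr j _)

theorem prodExpect_mono_left {r p : ι → β → ℝ} (hr : ∀ j z, 0 ≤ r j z) (hrp : ∀ j z, r j z ≤ p j z)
    {f : (ι → β) → ℝ} (hf : ∀ y, 0 ≤ f y) : prodExpect r f ≤ prodExpect p f :=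
  Finset.sum_le_sum fun y _ => mul_le_mul_of_nonneg_right
    (Finset.prod_le_prod (fun j _ => hr j _) fun j _ => hrp j _) (hf y)

theorem abs_prodExpect_le {r : ι → β → ℝ} (hr : ∀ j z, 0 ≤ r j z) (hr1 : ∀ j, ∑ z, r j z = 1)
    {f : (ι → β) → ℝ} {c : ℝ} (h : ∀ y, |f y| ≤ c) : |prodExpect r f| ≤ c := by
  refine abs_le.2 ⟨?_, ?_⟩
  · simpa only [prodExpect_const hr1] using prodExpect_mono hr fun y => (abs_le.1 (h y)).1
  · simpa only [prodExpect_const hr1] using prodExpect_mono hr fun y => (abs_le.1 (h y)).2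

theorem prodExpect_apply_eval {r : ι → β → ℝ} (hr : ∀ j, ∑ z, r j z = 1) (j₀ : ι) (f : β → ℝ) :
    prodExpect r (fun y => f (y j₀)) = ∑ z, r j₀ z * f z := by
  have h := prodExpect_prod r fun j z => if j = j₀ then f z else 1
  have hsingle : ∀ j, (∑ z, r j z * if j = j₀ then f z else 1) =
      if j = j₀ then ∑ z, r j₀ z * f z else 1 := fun j => by
    split_ifs with hj
    · rw [hj]
    · simp only [mul_one, hr]
  simpa only [hsingle, Finset.prod_ite_eq', Finset.mem_univ, if_true] using h

theorem prodExpect_prodExpect {γ : Type*} [Fintype γ] (w : ι → γ → ℝ) (p : γ → β → ℝ)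
    (f : (ι → β) → ℝ) :
    prodExpect w (fun X => prodExpect (fun j => p (X j)) f) =
      prodExpect (fun j z => ∑ x, w j x * p x z) f := by
  have hmix : ∀ y : ι → β, ∏ j, ∑ x, w j x * p x (y j) =
      ∑ X : ι → γ, (∏ j, w j (X j)) * ∏ j, p (X j) (y j) := fun y =>
    (prodExpect_prod w fun j x => p x (y j)).symm
  simp only [prodExpect, hmix, Finset.mul_sum, Finset.sum_mul, mul_assoc]
  exact Finset.sum_comm

theorem prodExpect_update {r : ι → β → ℝ} {j₀ : ι} (hr : ∑ z, r j₀ z = 1) (u : β → ℝ)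
    (f : (ι → β) → ℝ) :
    prodExpect (Function.update r j₀ u) f =
      prodExpect r fun y => ∑ z, u z * f (Function.update y j₀ z) := by
  let swap (q : (ι → β) × β) : (ι → β) × β := (Function.update q.1 j₀ q.2, q.1 j₀)
  have hswap : Function.Involutive swap := fun q => by simp [swap]
  let rest (y : ι → β) : ℝ := ∏ j ∈ Finset.univ.erase j₀, r j (y j)
  have hrest (y : ι → β) (z : β) : rest (Function.update y j₀ z) = rest y :=
    Finset.prod_congr rfl fun j hj => by rw [Function.update_of_ne (Finset.ne_of_mem_erase hj)]
  have hsplit (r' : β → ℝ) (y : ι → β) :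
      ∏ j, Function.update r j₀ r' j (y j) = r' (y j₀) * rest y := by
    rw [← Finset.mul_prod_erase _ _ (Finset.mem_univ j₀), Function.update_self]
    congr 1
    exact Finset.prod_congr rfl fun j hj => by
      rw [Function.update_of_ne (Finset.ne_of_mem_erase hj)]
  calc prodExpect (Function.update r j₀ u) f
      = ∑ y, ∑ z, u (y j₀) * rest y * f y * r j₀ z := by
        simp only [prodExpect, hsplit, ← Finset.mul_sum, hr, mul_one]
    _ = ∑ q : (ι → β) × β, u (q.1 j₀) * rest q.1 * f q.1 * r j₀ q.2 := by
        rw [Fintype.sum_prod_type]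
    _ = ∑ q : (ι → β) × β, r j₀ (q.1 j₀) * rest q.1 *
          (u q.2 * f (Function.update q.1 j₀ q.2)) := by
        refine Fintype.sum_bijective swap hswap.bijective _ _ fun q => ?_
        simp only [swap, Function.update_self, hrest, Function.update_idem, Function.update_eq_self]
        ring
    _ = prodExpect r fun y => ∑ z, u z * f (Function.update y j₀ z) := by
        have hself (y : ι → β) : ∏ j, r j (y j) = r j₀ (y j₀) * rest y := by
          simpa only [Function.update_eq_self] using hsplit (r j₀) y
        simp only [prodExpect, hself, Finset.mul_sum, Fintype.sum_prod_type]

/-- Replaces the coordinates one at a time. -/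
theorem abs_prodExpect_sub_prodExpect_le {u v : β → ℝ} (hu : ∀ z, 0 ≤ u z) (hu1 : ∑ z, u z = 1)
    (hv : ∀ z, 0 ≤ v z) (hv1 : ∑ z, v z = 1) {f : (ι → β) → ℝ} {c : ℝ}
    (h : ∀ j y, |∑ z, (u z - v z) * f (Function.update y j z)| ≤ c) :
    |prodExpect (fun _ => u) f - prodExpect (fun _ => v) f| ≤ Fintype.card ι * c := by
  let hybrid (s : Finset ι) (j : ι) : β → ℝ := if j ∈ s then u else v
  have hybrid_nonneg s j z : 0 ≤ hybrid s j z := by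
    simp only [hybrid]; split_ifs; exacts [hu z, hv z]
  have hybrid_sum s j : ∑ z, hybrid s j z = 1 := by
    simp only [hybrid]; split_ifs; exacts [hu1, hv1]
  have hstep (s : Finset ι) (a : ι) (ha : a ∉ s) :
      |prodExpect (hybrid (insert a s)) f - prodExpect (hybrid s) f| ≤ c := by
    have hu_update : hybrid (insert a s) = Function.update (hybrid s) a u := by
      ext j z
      rcases eq_or_ne j a with rfl | hj <;> simp [hybrid, *]
    have hv_update : Function.update (hybrid s) a v = hybrid s := by
      rw [Function.update_eq_self_iff]
      simp only [hybrid, ha, if_false]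
    rw [hu_update, ← congrArg (prodExpect · f) hv_update, prodExpect_update (hybrid_sum s a),
      prodExpect_update (hybrid_sum s a), ← prodExpect_sub]
    refine abs_prodExpect_le (hybrid_nonneg s) (hybrid_sum s) fun y => ?_
    simpa only [sub_mul, Finset.sum_sub_distrib] using h a y
  have hcard (s : Finset ι) :
      |prodExpect (hybrid s) f - prodExpect (hybrid ∅) f| ≤ s.card * c := by
    induction s using Finset.induction_on with
    | empty => simp
    | insert a s ha ih =>
      have := abs_sub_le (prodExpect (hybrid (insert a s)) f) (prodExpect (hybrid s) f)
        (prodExpect (hybrid ∅) f)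
      rw [Finset.card_insert_of_notMem ha]
      push_cast
      linarith [hstep s a ha]
  simpa [hybrid] using hcard Finset.univ

end ProductExpectation

section MomentMatching

theorem factorial_mul_prod_Icc_abs_sq_sub_sq (d m : ℕ) :
    (d.factorial : ℝ) * ((d + m + 1 : ℕ) *
      ∏ j ∈ Finset.Icc 1 m, |(j : ℝ) ^ 2 - ((d + m + 1 : ℕ) : ℝ) ^ 2|) =
      (d + 2 * m + 1).factorial := by
  induction m generalizing d with
  | zero => simp [Nat.factorial_succ, mul_comm]
  | succ m ih =>
    have hfactor : |((m + 1 : ℕ) : ℝ) ^ 2 - ((d + (m + 1) + 1 : ℕ) : ℝ) ^ 2| =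
        (d + 1) * (d + 2 * m + 3) := by
      rw [abs_sub_comm, abs_of_nonneg] <;> push_cast
      · ring
      · nlinarith only [Nat.cast_nonneg (α := ℝ) m, Nat.cast_nonneg (α := ℝ) d]
    have h := ih (d + 1)
    rw [show d + 1 + m + 1 = d + (m + 1) + 1 by ring, Nat.factorial_succ] at h
    rw [Finset.prod_Icc_succ_top (by omega), hfactor,
      show d + 2 * (m + 1) + 1 = (d + 1 + 2 * m + 1) + 1 by ring, Nat.factorial_succ, Nat.cast_mul,
      ← h]
    push_cast
    ring

theorem two_mul_sq_mul_prod_erase_abs_sq_sub_sq {i : ℕ} (hi : 1 ≤ i) (d : ℕ) :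
    2 * (i : ℝ) ^ 2 * ∏ j ∈ (Finset.Icc 1 (i + d)).erase i, |(j : ℝ) ^ 2 - (i : ℝ) ^ 2| =
      d.factorial * (2 * i + d).factorial := by
  induction d with
  | zero =>
    obtain ⟨m, rfl⟩ : ∃ m, i = m + 1 := ⟨i - 1, by omega⟩
    have herase : (Finset.Icc 1 (m + 1 + 0)).erase (m + 1) = Finset.Icc 1 m := by
      ext j; simp only [Finset.mem_erase, Finset.mem_Icc]; omega
    have h := factorial_mul_prod_Icc_abs_sq_sub_sq 0 m
    simp only [Nat.factorial_zero, Nat.cast_one, one_mul, zero_add] at h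
    rw [herase, show 2 * (m + 1) + 0 = (2 * m + 1) + 1 by ring, Nat.factorial_succ, Nat.cast_mul,
      ← h, Nat.factorial_zero]
    push_cast
    ring
  | succ d ih =>
    have herase : (Finset.Icc 1 (i + (d + 1))).erase i =
        insert (i + d + 1) ((Finset.Icc 1 (i + d)).erase i) := by
      ext j; simp only [Finset.mem_erase, Finset.mem_insert, Finset.mem_Icc]; omega
    have hfactor : |((i + d + 1 : ℕ) : ℝ) ^ 2 - (i : ℝ) ^ 2| = (d + 1) * (2 * i + d + 1) := by
      rw [abs_of_nonneg] <;> push_cast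
      · ring
      · nlinarith only [Nat.cast_nonneg (α := ℝ) i, Nat.cast_nonneg (α := ℝ) d]
    rw [herase, Finset.prod_insert (by simp), hfactor, mul_left_comm, ih,
      show 2 * i + (d + 1) = (2 * i + d) + 1 by ring, Nat.factorial_succ, Nat.factorial_succ]
    push_cast
    ring

theorem factorial_sq_le_factorial_mul_factorial (i d : ℕ) :
    (i + d).factorial ^ 2 ≤ d.factorial * (2 * i + d).factorial := by
  calc (i + d).factorial ^ 2
      = d.factorial * (i + d).descFactorial i * (i + d).factorial := by
        rw [sq, ← Nat.factorial_mul_descFactorial (Nat.le_add_right i d), Nat.add_sub_cancel_left]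
    _ ≤ d.factorial * (i + d + 1) ^ i * (i + d).factorial := by
        gcongr
        exact (Nat.descFactorial_le_pow _ _).trans (Nat.pow_le_pow_left (Nat.le_succ _) _)
    _ = d.factorial * ((i + d).factorial * (i + d + 1) ^ i) := by ring
    _ ≤ d.factorial * (i + d + i).factorial := by
        gcongr
        exact Nat.factorial_mul_pow_le_factorial
    _ = d.factorial * (2 * i + d).factorial := by rw [show i + d + i = 2 * i + d by ring]

theorem prod_erase_sq_div_abs_sq_sub_sq_le {i κ : ℕ} (hi : 1 ≤ i) (hκ : i ≤ κ) :
    ∏ j ∈ (Finset.Icc 1 κ).erase i, ((j : ℝ) ^ 2 / |(j : ℝ) ^ 2 - (i : ℝ) ^ 2|) ≤ 2 := by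
  obtain ⟨d, rfl⟩ := Nat.exists_eq_add_of_le hκ
  have hi0 : (0 : ℝ) < i := by exact_mod_cast hi
  have hnum : (i : ℝ) ^ 2 * ∏ j ∈ (Finset.Icc 1 (i + d)).erase i, (j : ℝ) ^ 2 =
      ((i + d).factorial : ℝ) ^ 2 := by
    rw [Finset.mul_prod_erase _ (fun j : ℕ => (j : ℝ) ^ 2) (Finset.mem_Icc.2 ⟨hi, hκ⟩),
      Finset.prod_pow, ← Nat.cast_prod, ← Finset.Ico_add_one_right_eq_Icc,
      Finset.prod_Ico_id_eq_factorial]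
  have hden := two_mul_sq_mul_prod_erase_abs_sq_sub_sq hi d
  have hle : ((i + d).factorial : ℝ) ^ 2 ≤ d.factorial * (2 * i + d).factorial := by
    exact_mod_cast factorial_sq_le_factorial_mul_factorial i d
  have hden_pos :
      0 < ∏ j ∈ (Finset.Icc 1 (i + d)).erase i, |(j : ℝ) ^ 2 - (i : ℝ) ^ 2| := by
    have : (0 : ℝ) < d.factorial * (2 * i + d).factorial := by positivity
    rw [← hden] at this
    exact pos_of_mul_pos_right this (by positivity)
  rw [Finset.prod_div_distrib, div_le_iff₀ hden_pos]
  rw [← hnum, ← hden] at hle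
  exact le_of_mul_le_mul_left (by linarith) (pow_pos hi0 2)

theorem prod_erase_sq_div_sq_add_sq_le (i κ : ℕ) (hκ : i ≤ κ) :
    ∏ j ∈ (Finset.Icc 1 κ).erase i, ((j : ℝ) ^ 2 / ((j : ℝ) ^ 2 + (i : ℝ) ^ 2)) ≤
      (1 / 2) ^ (i - 1) := by
  have hfactor : ∀ j ∈ (Finset.Icc 1 κ).erase i,
      (j : ℝ) ^ 2 / ((j : ℝ) ^ 2 + (i : ℝ) ^ 2) ≤ if j < i then (1 / 2 : ℝ) else 1 := by
    intro j hj
    have hj0 : (0 : ℝ) < j := by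
      exact_mod_cast (Finset.mem_Icc.1 (Finset.mem_of_mem_erase hj)).1
    split_ifs with hji
    · have : (j : ℝ) ^ 2 ≤ (i : ℝ) ^ 2 := by gcongr
      rw [div_le_div_iff₀ (by positivity) two_pos]
      linarith
    · exact div_le_one_of_le₀ (le_add_of_nonneg_right (sq_nonneg _)) (by positivity)
  have hfilter : ((Finset.Icc 1 κ).erase i).filter (· < i) = Finset.Icc 1 (i - 1) := by
    ext j; simp only [Finset.mem_filter, Finset.mem_erase, Finset.mem_Icc]; omega
  refine (Finset.prod_le_prod (fun j _ => by positivity) hfactor).trans_eq ?_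
  rw [Finset.prod_ite, Finset.prod_const, Finset.prod_const_one, mul_one, hfilter, Nat.card_Icc,
    Nat.add_sub_cancel]

theorem prod_erase_pow_four_div_le {i κ : ℕ} (hi : 1 ≤ i) (hκ : i ≤ κ) :
    ∏ j ∈ (Finset.Icc 1 κ).erase i, ((j : ℝ) ^ 4 / |(j : ℝ) ^ 4 - (i : ℝ) ^ 4|) ≤
      2 * (1 / 2) ^ (i - 1) := by
  have : (0 : ℝ) < i := by exact_mod_cast hi
  have hfactor (j : ℕ) : (j : ℝ) ^ 4 / |(j : ℝ) ^ 4 - (i : ℝ) ^ 4| =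
      (j : ℝ) ^ 2 / |(j : ℝ) ^ 2 - (i : ℝ) ^ 2| * ((j : ℝ) ^ 2 / ((j : ℝ) ^ 2 + (i : ℝ) ^ 2)) := by
    have hdiff : (j : ℝ) ^ 4 - (i : ℝ) ^ 4 =
        ((j : ℝ) ^ 2 - (i : ℝ) ^ 2) * ((j : ℝ) ^ 2 + (i : ℝ) ^ 2) := by ring
    rw [hdiff, abs_mul, abs_of_pos (a := (j : ℝ) ^ 2 + (i : ℝ) ^ 2) (by positivity),
      div_mul_div_comm]
    ring
  simp only [hfactor, Finset.prod_mul_distrib]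
  exact mul_le_mul (prod_erase_sq_div_abs_sq_sub_sq_le hi hκ)
    (prod_erase_sq_div_sq_add_sq_le i κ hκ) (Finset.prod_nonneg fun j _ => by positivity) two_pos.le

/-- The support points of the moment-matching distributions. The fourth power makes the products
of `prod_erase_pow_four_div_le` decay geometrically, and `node 1 = 8` makes an element of intensity
`node i ≠ 0` absent from a random dataset with probability at most `exp (-8)`. -/
noncomputable def node (i : ℕ) : ℝ := 8 * (i : ℝ) ^ 4

theorem node_zero : node 0 = 0 := by simp [node]

theorem node_nonneg (i : ℕ) : 0 ≤ node i := by unfold node; positivity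

theorem node_strictMono : StrictMono node := fun i j hij => by
  have : (i : ℝ) < j := by exact_mod_cast hij
  unfold node
  gcongr

/-- The weight of `node i` in the divided difference over `node 0, …, node κ`, which annihilates
polynomials of degree less than `κ`; normalized to have weight `1` at `node 0`. -/
noncomputable def nodeWeight (κ i : ℕ) : ℝ :=
  (∏ j ∈ (Finset.range (κ + 1)).erase 0, (node 0 - node j)) /
    ∏ j ∈ (Finset.range (κ + 1)).erase i, (node i - node j)

theorem sum_nodeWeight_mul_pow {κ k : ℕ} (hk : k < κ) :
    ∑ i ∈ Finset.range (κ + 1), nodeWeight κ i * node i ^ k = 0 := by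
  have hcoeff := Lagrange.coeff_eq_sum (s := Finset.range (κ + 1)) (v := node)
    node_strictMono.injective.injOn (P := (Polynomial.X : Polynomial ℝ) ^ k)
    (by rw [Polynomial.degree_X_pow, Finset.card_range]; exact_mod_cast hk.trans_le (Nat.le_succ κ))
  rw [Polynomial.coeff_X_pow, Finset.card_range, if_neg (by omega)] at hcoeff
  simp only [Polynomial.eval_pow, Polynomial.eval_X] at hcoeff
  simp only [nodeWeight, div_mul_eq_mul_div, mul_div_assoc, ← Finset.mul_sum]
  rw [← hcoeff, mul_zero]

theorem nodeWeight_zero (κ : ℕ) : nodeWeight κ 0 = 1 :=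
  div_self <| Finset.prod_ne_zero_iff.2 fun _ hj => sub_ne_zero.2 fun h =>
    Finset.ne_of_mem_erase hj (node_strictMono.injective h).symm

theorem abs_nodeWeight_le {κ i : ℕ} (hi : 1 ≤ i) (hκ : i ≤ κ) :
    |nodeWeight κ i| ≤ 2 * (1 / 2) ^ (i - 1) := by
  refine le_trans (le_of_eq ?_) (prod_erase_pow_four_div_le hi hκ)
  have herase_zero :
      (Finset.range (κ + 1)).erase 0 = insert i ((Finset.Icc 1 κ).erase i) := by
    ext j; simp only [Finset.mem_erase, Finset.mem_insert, Finset.mem_range, Finset.mem_Icc]; omega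
  have herase : (Finset.range (κ + 1)).erase i = insert 0 ((Finset.Icc 1 κ).erase i) := by
    ext j; simp only [Finset.mem_erase, Finset.mem_insert, Finset.mem_range, Finset.mem_Icc]; omega
  have hnode : |node i| ≠ 0 := abs_ne_zero.2 (node_zero ▸ (node_strictMono hi).ne')
  rw [nodeWeight, herase_zero, herase, Finset.prod_insert (by simp), Finset.prod_insert (by simp),
    node_zero, zero_sub, sub_zero, abs_div, abs_mul, abs_mul, abs_neg,
    mul_div_mul_left _ _ hnode, Finset.abs_prod, Finset.abs_prod, ← Finset.prod_div_distrib]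
  refine Finset.prod_congr rfl fun j _ => ?_
  rw [zero_sub, abs_neg, node, node, ← mul_sub, abs_mul, abs_mul,
    mul_div_mul_left _ _ (by norm_num), abs_of_nonneg (a := (j : ℝ) ^ 4) (by positivity),
    abs_sub_comm]

theorem sum_abs_nodeWeight_le (κ : ℕ) : ∑ i : Fin (κ + 1), |nodeWeight κ i| ≤ 5 := by
  have hterm (i : Fin κ) : |nodeWeight κ i.succ| ≤ 2 * (1 / 2) ^ (i : ℕ) := by
    simpa using abs_nodeWeight_le (κ := κ) (i := i + 1) (by omega) (by omega)
  have hgeom : ∑ i : Fin κ, (1 / 2 : ℝ) ^ (i : ℕ) ≤ 2 := by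
    rw [Fin.sum_univ_eq_sum_range (fun i => (1 / 2 : ℝ) ^ i)]
    exact sum_geometric_two_le κ
  have htail := Finset.sum_le_sum fun i (_ : i ∈ Finset.univ) => hterm i
  rw [← Finset.mul_sum] at htail
  rw [Fin.sum_univ_succ, Fin.val_zero, nodeWeight_zero, abs_one]
  linarith

theorem two_mul_sum_posPart {ι : Type*} [Fintype ι] {a : ι → ℝ} (ha : ∑ i, a i = 0) :
    2 * ∑ i, (a i)⁺ = ∑ i, |a i| := by
  have hsub : ∑ i, (a i)⁺ - ∑ i, (a i)⁻ = 0 := by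
    rw [← Finset.sum_sub_distrib]
    simpa only [posPart_sub_negPart] using ha
  have hadd : ∑ i, (a i)⁺ + ∑ i, (a i)⁻ = ∑ i, |a i| := by
    rw [← Finset.sum_add_distrib]
    simp only [posPart_add_negPart]
  linarith

/-- The two vectors are the normalized positive and negative parts of the divided difference. -/
theorem exists_moment_matching {κ : ℕ} (hκ : 0 < κ) :
    ∃ u v : Fin (κ + 1) → ℝ, (∀ i, 0 ≤ u i) ∧ (∀ i, 0 ≤ v i) ∧ ∑ i, u i = 1 ∧ ∑ i, v i = 1 ∧
      2 / 5 ≤ u 0 ∧ v 0 = 0 ∧ ∀ k < κ, ∑ i, (u i - v i) * node i ^ k = 0 := by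
  let a (i : Fin (κ + 1)) : ℝ := nodeWeight κ i
  have ha_zero : a 0 = 1 := nodeWeight_zero κ
  have ha_moment : ∀ k < κ, ∑ i, a i * node i ^ k = 0 := fun k hk => by
    simpa only [← Fin.sum_univ_eq_sum_range (fun i => nodeWeight κ i * node i ^ k)] using
      sum_nodeWeight_mul_pow hk
  have ha_sum : ∑ i, a i = 0 := by simpa only [pow_zero, mul_one] using ha_moment 0 hκ
  have ha_neg_sum : ∑ i, -a i = 0 := by rw [Finset.sum_neg_distrib, ha_sum, neg_zero]
  set N := ∑ i, |a i|
  have hN_le : N ≤ 5 := sum_abs_nodeWeight_le κ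
  have hN_pos : 0 < N := lt_of_lt_of_le (by rw [ha_zero]; norm_num)
    (Finset.single_le_sum (fun i _ => abs_nonneg (a i)) (Finset.mem_univ 0))
  refine ⟨fun i => 2 * (a i)⁺ / N, fun i => 2 * (a i)⁻ / N,
    fun i => div_nonneg (mul_nonneg two_pos.le (posPart_nonneg _)) hN_pos.le,
    fun i => div_nonneg (mul_nonneg two_pos.le (negPart_nonneg _)) hN_pos.le, ?_, ?_, ?_, ?_,
    fun k hk => ?_⟩
  · rw [← Finset.sum_div, ← Finset.mul_sum, two_mul_sum_posPart ha_sum, div_self hN_pos.ne']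
  · simp only [← posPart_neg]
    rw [← Finset.sum_div, ← Finset.mul_sum, two_mul_sum_posPart ha_neg_sum]
    simp only [abs_neg]
    exact div_self hN_pos.ne'
  · simp only [ha_zero, posPart_of_nonneg zero_le_one, mul_one]
    exact div_le_div_of_nonneg_left two_pos.le hN_pos hN_le
  · simp only [ha_zero, negPart_of_nonneg zero_le_one, mul_zero, zero_div]
  · have hterm (i) : (2 * (a i)⁺ / N - 2 * (a i)⁻ / N) * node i ^ k =
        2 / N * (a i * node i ^ k) := by
      rw [← sub_div, ← mul_sub, posPart_sub_negPart]
      ring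
    simp only [hterm]
    rw [← Finset.mul_sum, ha_moment k hk, mul_zero]

end MomentMatching

section ChiSquared

variable {β I : Type*} [Fintype β] [Fintype I]

theorem sum_prod_affine_mul_prod_affine_div {b d : β → ℝ} (hb : ∀ z, 0 < b z)
    (hb1 : ∑ z, b z = 1) (hd : ∑ z, d z = 0) (n : ℕ) (s t : ℝ) :
    ∑ y : Fin n → β, (∏ j, (b (y j) + s * d (y j))) * (∏ j, (b (y j) + t * d (y j))) /
      ∏ j, b (y j) = (s * t * ∑ z, d z ^ 2 / b z + 1) ^ n := by
  have hpoint (z : β) : (b z + s * d z) * (b z + t * d z) / b z =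
      b z + (s + t) * d z + s * t * (d z ^ 2 / b z) := by
    field_simp [(hb z).ne']
    ring
  have hone : s * t * ∑ z, d z ^ 2 / b z + 1 =
      ∑ z, (b z + s * d z) * (b z + t * d z) / b z := by
    simp only [hpoint, Finset.sum_add_distrib, ← Finset.mul_sum, hb1, hd]
    ring
  rw [hone, Fintype.sum_pow]
  exact Finset.sum_congr rfl fun y _ => by rw [Finset.prod_div_distrib, Finset.prod_mul_distrib]

theorem sum_sq_mixture_div {b d : β → ℝ} (hb : ∀ z, 0 < b z) (hb1 : ∑ z, b z = 1)
    (hd : ∑ z, d z = 0) (n : ℕ) (w α : I → ℝ) :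
    ∑ y : Fin n → β, (∑ i, w i * ∏ j, (b (y j) + α i * d (y j))) ^ 2 / ∏ j, b (y j) =
      ∑ k ∈ Finset.range (n + 1),
        (n.choose k : ℝ) * (∑ z, d z ^ 2 / b z) ^ k * (∑ i, w i * α i ^ k) ^ 2 := by
  set χ := ∑ z, d z ^ 2 / b z with hχ
  calc ∑ y : Fin n → β, (∑ i, w i * ∏ j, (b (y j) + α i * d (y j))) ^ 2 / ∏ j, b (y j)
      = ∑ y : Fin n → β, ∑ i, ∑ i', w i * w i' * ((∏ j, (b (y j) + α i * d (y j))) *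
          (∏ j, (b (y j) + α i' * d (y j))) / ∏ j, b (y j)) := by
        refine Finset.sum_congr rfl fun y _ => ?_
        simp only [sq, Finset.sum_mul_sum, Finset.sum_div]
        exact Finset.sum_congr rfl fun i _ => Finset.sum_congr rfl fun i' _ => by ring
    _ = ∑ i, ∑ i', w i * w i' * (α i * α i' * χ + 1) ^ n := by
        rw [Finset.sum_comm]
        refine Finset.sum_congr rfl fun i _ => ?_
        rw [Finset.sum_comm]
        simp only [← Finset.mul_sum, sum_prod_affine_mul_prod_affine_div hb hb1 hd n, ← hχ]
    _ = ∑ i, ∑ i', ∑ k ∈ Finset.range (n + 1),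
          (n.choose k : ℝ) * χ ^ k * ((w i * α i ^ k) * (w i' * α i' ^ k)) := by
        refine Finset.sum_congr rfl fun i _ => Finset.sum_congr rfl fun i' _ => ?_
        rw [add_pow, Finset.mul_sum]
        exact Finset.sum_congr rfl fun k _ => by rw [one_pow, mul_pow, mul_pow]; ring
    _ = ∑ k ∈ Finset.range (n + 1), (n.choose k : ℝ) * χ ^ k * (∑ i, w i * α i ^ k) ^ 2 := by
        rw [Finset.sum_congr rfl fun i _ => Finset.sum_comm, Finset.sum_comm]
        refine Finset.sum_congr rfl fun k _ => ?_
        rw [sq, Finset.sum_mul_sum]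
        simp only [Finset.mul_sum]

theorem sq_sum_mul_le_sum_sq_div {ι : Type*} [Fintype ι] {B g φ : ι → ℝ} (hB : ∀ y, 0 < B y)
    (hB1 : ∑ y, B y = 1) (hφ : ∀ y, |φ y| ≤ 1) :
    (∑ y, g y * φ y) ^ 2 ≤ ∑ y, g y ^ 2 / B y := by
  have h := Finset.sq_sum_div_le_sum_sq_div Finset.univ (fun y => g y * φ y) fun y _ => hB y
  rw [hB1, div_one] at h
  refine h.trans (Finset.sum_le_sum fun y _ => div_le_div_of_nonneg_right ?_ (hB y).le)
  rw [mul_pow]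
  exact mul_le_of_le_one_right (sq_nonneg _) ((sq_le_one_iff_abs_le_one _).2 (hφ y))

theorem abs_sum_mul_pow_le (w : I → ℝ) {α : I → ℝ} {A : ℝ} (hα : ∀ i, |α i| ≤ A) (k : ℕ) :
    |∑ i, w i * α i ^ k| ≤ (∑ i, |w i|) * A ^ k := by
  refine (Finset.abs_sum_le_sum_abs _ _).trans ?_
  rw [Finset.sum_mul]
  refine Finset.sum_le_sum fun i _ => ?_
  rw [abs_mul, abs_pow]
  exact mul_le_mul_of_nonneg_left (pow_le_pow_left₀ (abs_nonneg _) (hα i) k) (abs_nonneg _)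

theorem choose_mul_pow_le (n k : ℕ) {z : ℝ} (hz : 0 ≤ z) :
    n.choose k * z ^ k ≤ (Real.exp 1 * n * z / k) ^ k := by
  rcases Nat.eq_zero_or_pos k with rfl | hk
  · simp
  have hk' : (0 : ℝ) < k := by exact_mod_cast hk
  have hexp : (k : ℝ) ^ k / k.factorial ≤ Real.exp 1 ^ k := by
    rw [← Real.exp_nat_mul, mul_one]
    exact Real.pow_div_factorial_le_exp k hk'.le k
  calc n.choose k * z ^ k ≤ (n : ℝ) ^ k / k.factorial * z ^ k := by
        gcongr
        exact Nat.choose_le_pow_div k n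
    _ = (n * z / k) ^ k * ((k : ℝ) ^ k / k.factorial) := by
        rw [div_pow, mul_pow]
        field_simp
    _ ≤ (n * z / k) ^ k * Real.exp 1 ^ k := by gcongr
    _ = (Real.exp 1 * n * z / k) ^ k := by rw [← mul_pow]; ring

theorem sum_Ico_choose_mul_pow_le {n κ : ℕ} (hκ : 0 < κ) {z ρ : ℝ} (hz : 0 ≤ z)
    (hρ : ρ ≤ 1 / 2) (h : Real.exp 1 * n * z ≤ ρ * κ) :
    ∑ k ∈ Finset.Ico κ (n + 1), (n.choose k : ℝ) * z ^ k ≤ 2 * ρ ^ κ := by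
  have hκ' : (0 : ℝ) < κ := by exact_mod_cast hκ
  have hρ0 : 0 ≤ ρ := nonneg_of_mul_nonneg_left (le_trans (by positivity) h) hκ'
  have hterm : ∀ k ∈ Finset.Ico κ (n + 1), (n.choose k : ℝ) * z ^ k ≤ ρ ^ k := fun k hk => by
    have hκk : (κ : ℝ) ≤ k := by exact_mod_cast (Finset.mem_Ico.1 hk).1
    refine (choose_mul_pow_le n k hz).trans (pow_le_pow_left₀ (by positivity) ?_ k)
    rw [div_le_iff₀ (hκ'.trans_le hκk)]
    exact h.trans (mul_le_mul_of_nonneg_left hκk hρ0)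
  calc ∑ k ∈ Finset.Ico κ (n + 1), (n.choose k : ℝ) * z ^ k
      ≤ ∑ k ∈ Finset.Ico κ (n + 1), ρ ^ k := Finset.sum_le_sum hterm
    _ ≤ ρ ^ κ / (1 - ρ) := geom_sum_Ico_le_of_lt_one hρ0 (by linarith)
    _ ≤ 2 * ρ ^ κ := by
        rw [div_le_iff₀ (by linarith)]
        nlinarith [pow_nonneg hρ0 κ]

theorem abs_sum_mul_prodExpect_affine_le {n κ : ℕ} (hκ : 0 < κ) {b d : β → ℝ} (hb : ∀ z, 0 < b z)
    (hb1 : ∑ z, b z = 1) (hd : ∑ z, d z = 0) {w α : I → ℝ} {A χ ρ : ℝ} (hA : 0 ≤ A)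
    (hα : ∀ i, |α i| ≤ A) (hw : ∑ i, |w i| ≤ 2) (hmoment : ∀ k < κ, ∑ i, w i * α i ^ k = 0)
    (hχ : ∑ z, d z ^ 2 / b z ≤ χ) (hρ : ρ ≤ 1 / 2) (h : Real.exp 1 * n * (χ * A ^ 2) ≤ ρ * κ)
    {φ : (Fin n → β) → ℝ} (hφ : ∀ y, |φ y| ≤ 1) :
    |∑ i, w i * prodExpect (fun _ z => b z + α i * d z) φ| ≤ √(8 * ρ ^ κ) := by
  set s := ∑ z, d z ^ 2 / b z
  have hs : 0 ≤ s := Finset.sum_nonneg fun z _ => div_nonneg (sq_nonneg _) (hb z).le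
  have hprod1 : ∑ y : Fin n → β, ∏ j, b (y j) = 1 := by rw [← Fintype.sum_pow, hb1, one_pow]
  have hswap : ∑ i, w i * prodExpect (fun _ z => b z + α i * d z) φ =
      ∑ y : Fin n → β, (∑ i, w i * ∏ j, (b (y j) + α i * d (y j))) * φ y := by
    simp only [prodExpect, Finset.mul_sum, Finset.sum_mul, mul_assoc]
    exact Finset.sum_comm
  have hterm (k : ℕ) : (n.choose k : ℝ) * s ^ k * (∑ i, w i * α i ^ k) ^ 2 ≤
      4 * (n.choose k * (s * A ^ 2) ^ k) := by
    have hsum : |∑ i, w i * α i ^ k| ≤ 2 * A ^ k :=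
      (abs_sum_mul_pow_le w hα k).trans (mul_le_mul_of_nonneg_right hw (pow_nonneg hA k))
    calc (n.choose k : ℝ) * s ^ k * (∑ i, w i * α i ^ k) ^ 2
        ≤ (n.choose k : ℝ) * s ^ k * (2 * A ^ k) ^ 2 := by
          rw [← sq_abs (∑ i, w i * α i ^ k)]; gcongr
      _ = 4 * (n.choose k * (s * A ^ 2) ^ k) := by ring
  rw [hswap]
  refine Real.abs_le_sqrt ?_
  calc (∑ y : Fin n → β, (∑ i, w i * ∏ j, (b (y j) + α i * d (y j))) * φ y) ^ 2
      ≤ ∑ k ∈ Finset.range (n + 1), (n.choose k : ℝ) * s ^ k * (∑ i, w i * α i ^ k) ^ 2 := by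
        rw [← sum_sq_mixture_div hb hb1 hd]
        exact sq_sum_mul_le_sum_sq_div (fun y => Finset.prod_pos fun j _ => hb _) hprod1 hφ
    _ = ∑ k ∈ Finset.Ico κ (n + 1), (n.choose k : ℝ) * s ^ k * (∑ i, w i * α i ^ k) ^ 2 := by
        symm
        refine Finset.sum_subset (fun k hk => ?_) fun k hk hk' => ?_
        · exact Finset.mem_range.2 (Finset.mem_Ico.1 hk).2
        · have : k < κ := by
            simp only [Finset.mem_range, Finset.mem_Ico] at hk hk'; omega
          rw [hmoment k this, zero_pow two_ne_zero, mul_zero]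
    _ ≤ ∑ k ∈ Finset.Ico κ (n + 1), 4 * (n.choose k * (s * A ^ 2) ^ k) :=
        Finset.sum_le_sum fun k _ => hterm k
    _ ≤ 8 * ρ ^ κ := by
        have hle : Real.exp 1 * n * (s * A ^ 2) ≤ ρ * κ := le_trans (by gcongr) h
        have := sum_Ico_choose_mul_pow_le hκ (mul_nonneg hs (sq_nonneg A)) hρ hle
        rw [← Finset.mul_sum]
        linarith

end ChiSquared

section RandomDataset

variable {β I 𝒳 : Type*} [Fintype β] [Fintype I] [Fintype 𝒳] [DecidableEq 𝒳]

/-- The distribution of the input of one user who holds `x` with probability `a x` and the default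
element `x₀` with the remaining probability. -/
noncomputable def inputDist (x₀ : 𝒳) (a : 𝒳 → ℝ) (x : 𝒳) : ℝ :=
  a x + if x = x₀ then 1 - ∑ m, a m else 0

theorem inputDist_nonneg {a : 𝒳 → ℝ} (ha : ∀ x, 0 ≤ a x) (ha1 : ∑ x, a x ≤ 1) (x₀ x : 𝒳) :
    0 ≤ inputDist x₀ a x := by
  refine add_nonneg (ha x) ?_
  split_ifs
  exacts [sub_nonneg.2 ha1, le_rfl]

theorem le_inputDist {a : 𝒳 → ℝ} (ha1 : ∑ x, a x ≤ 1) (x₀ x : 𝒳) : a x ≤ inputDist x₀ a x := by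
  refine le_add_of_nonneg_right ?_
  split_ifs
  exacts [sub_nonneg.2 ha1, le_rfl]

theorem sum_inputDist_mul (x₀ : 𝒳) (a f : 𝒳 → ℝ) :
    ∑ x, inputDist x₀ a x * f x = f x₀ + ∑ m, a m * (f m - f x₀) := by
  simp only [inputDist, add_mul, ite_mul, zero_mul, Finset.sum_add_distrib, Finset.sum_ite_eq',
    Finset.mem_univ, if_true, mul_sub, Finset.sum_sub_distrib, ← Finset.sum_mul]
  ring

theorem sum_inputDist (x₀ : 𝒳) (a : 𝒳 → ℝ) : ∑ x, inputDist x₀ a x = 1 := by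
  simpa using sum_inputDist_mul x₀ a fun _ => 1

theorem sum_inputDist_update_mul (x₀ : 𝒳) (a f : 𝒳 → ℝ) (m : 𝒳) (t : ℝ) :
    ∑ x, inputDist x₀ (Function.update a m t) x * f x =
      ∑ x, inputDist x₀ (Function.update a m 0) x * f x + t * (f m - f x₀) := by
  have hrest (s : ℝ) : ∑ x, Function.update a m s x * (f x - f x₀) =
      s * (f m - f x₀) + ∑ x ∈ Finset.univ.erase m, a x * (f x - f x₀) := by
    rw [← Finset.add_sum_erase _ _ (Finset.mem_univ m), Function.update_self]
    congr 1
    exact Finset.sum_congr rfl fun x hx => by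
      rw [Function.update_of_ne (Finset.ne_of_mem_erase hx)]
  simp only [sum_inputDist_mul, hrest]
  ring

theorem half_le_sum_inputDist_mul {a f : 𝒳 → ℝ} (ha : ∀ x, 0 ≤ a x) (ha1 : ∑ x, a x ≤ 1 / 2)
    (hf : ∀ x, 0 ≤ f x) (x₀ : 𝒳) : f x₀ / 2 ≤ ∑ x, inputDist x₀ a x * f x := by
  have hpos : 0 ≤ ∑ m, a m * f m := Finset.sum_nonneg fun m _ => mul_nonneg (ha m) (hf m)
  have hloss : (∑ m, a m) * f x₀ ≤ 1 / 2 * f x₀ := mul_le_mul_of_nonneg_right ha1 (hf x₀)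
  simp only [sum_inputDist_mul, mul_sub, Finset.sum_sub_distrib, ← Finset.sum_mul]
  linarith

theorem sum_le_of_forall_le {ι : Type*} [Fintype ι] {a : ι → ℝ} {A c : ℝ} (ha : ∀ x, a x ≤ A)
    (hA : Fintype.card ι * A ≤ c) : ∑ x, a x ≤ c :=
  (Finset.sum_le_card_nsmul _ _ _ fun x _ => ha x).trans (by rwa [nsmul_eq_mul])

theorem sum_sq_sub_div_le {p q b : β → ℝ} {K : ℝ} (hp : ∀ z, 0 ≤ p z) (hp1 : ∑ z, p z = 1)
    (hq : ∀ z, 0 < q z) (hq1 : ∑ z, q z = 1) (hpq : ∀ z, p z ≤ K * q z)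
    (hb : ∀ z, q z / 2 ≤ b z) : ∑ z, (p z - q z) ^ 2 / b z ≤ 4 * K := by
  have hK : 1 ≤ K := by
    simpa only [← Finset.mul_sum, hp1, hq1, mul_one] using
      Finset.sum_le_sum fun z (_ : z ∈ Finset.univ) => hpq z
  have hterm (z : β) : (p z - q z) ^ 2 / b z ≤ 2 * K * (p z + q z) := by
    have hb0 : 0 < b z := (half_pos (hq z)).trans_le (hb z)
    have hKq : |p z - q z| ≤ K * q z := abs_sub_le_iff.2
      ⟨by linarith [hpq z, hq z], by nlinarith [hp z, hq z]⟩
    have hadd : |p z - q z| ≤ p z + q z := abs_sub_le_iff.2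
      ⟨by linarith [hq z], by linarith [hp z]⟩
    rw [div_le_iff₀ hb0]
    calc (p z - q z) ^ 2 = |p z - q z| * |p z - q z| := by rw [← sq, sq_abs]
      _ ≤ (K * q z) * (p z + q z) :=
        mul_le_mul hKq hadd (abs_nonneg _) ((abs_nonneg _).trans hKq)
      _ = 2 * K * (p z + q z) * (q z / 2) := by ring
      _ ≤ 2 * K * (p z + q z) * b z := mul_le_mul_of_nonneg_left (hb z) <|
        mul_nonneg (by linarith) (add_nonneg (hp z) (hq z).le)
  calc ∑ z, (p z - q z) ^ 2 / b z ≤ ∑ z, 2 * K * (p z + q z) :=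
        Finset.sum_le_sum fun z _ => hterm z
    _ = 4 * K := by rw [← Finset.mul_sum, Finset.sum_add_distrib, hp1, hq1]; ring

theorem abs_sum_mul_prodExpect_inputDist_update_le {n κ : ℕ} (hκ : 0 < κ) {x₀ : 𝒳}
    {p : 𝒳 → β → ℝ} {K : ℝ} (hp : ∀ x z, 0 ≤ p x z) (hp1 : ∀ x, ∑ z, p x z = 1)
    (hp₀ : ∀ z, 0 < p x₀ z) (hpK : ∀ x z, p x z ≤ K * p x₀ z) {w c : I → ℝ} {A ρ : ℝ}
    (hw : ∑ i, |w i| ≤ 2) (hA : 0 ≤ A) (hcA : ∀ i, |c i| ≤ A)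
    (hmoment : ∀ k < κ, ∑ i, w i * c i ^ k = 0) (hρ : ρ ≤ 1 / 2)
    (h : Real.exp 1 * n * (4 * K * A ^ 2) ≤ ρ * κ) {φ : (Fin n → β) → ℝ} (hφ : ∀ y, |φ y| ≤ 1)
    {a : 𝒳 → ℝ} (ha : ∀ x, 0 ≤ a x) (ha1 : ∑ x, a x ≤ 1 / 2) (m : 𝒳) :
    |∑ i, w i * prodExpect
      (fun _ z => ∑ x, inputDist x₀ (Function.update a m (c i)) x * p x z) φ| ≤
        √(8 * ρ ^ κ) := by
  have hle : Function.update a m 0 ≤ a := update_le_iff.2 ⟨ha m, fun _ _ => le_rfl⟩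
  have hupdate (x : 𝒳) : 0 ≤ Function.update a m 0 x :=
    (le_update_iff (x := 0) (y := a)).2 ⟨le_rfl, fun x _ => ha x⟩ x
  have hupdate1 : ∑ x, Function.update a m 0 x ≤ 1 / 2 :=
    (Finset.sum_le_sum fun x _ => hle x).trans ha1
  simp only [sum_inputDist_update_mul x₀ a _ m (c _)]
  set b : β → ℝ := fun z => ∑ x, inputDist x₀ (Function.update a m 0) x * p x z with hb
  have hb_half (z : β) : p x₀ z / 2 ≤ b z :=
    half_le_sum_inputDist_mul hupdate hupdate1 (fun x => hp x z) x₀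
  have hb_sum : ∑ z, b z = 1 := by
    rw [hb, Finset.sum_comm]
    simp only [← Finset.mul_sum, hp1, mul_one, sum_inputDist]
  exact abs_sum_mul_prodExpect_affine_le hκ (fun z => (half_pos (hp₀ z)).trans_le (hb_half z))
    hb_sum (by rw [Finset.sum_sub_distrib, hp1, hp1, sub_self]) hA hcA hw hmoment
    (sum_sq_sub_div_le (hp m) (hp1 m) hp₀ (hp1 x₀) (hpK m) hb_half) hρ h hφ

theorem abs_prodExpect_mixture_sub_le {n κ : ℕ} (hκ : 0 < κ) {x₀ : 𝒳} {p : 𝒳 → β → ℝ} {K : ℝ}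
    (hp : ∀ x z, 0 ≤ p x z) (hp1 : ∀ x, ∑ z, p x z = 1) (hp₀ : ∀ z, 0 < p x₀ z)
    (hpK : ∀ x z, p x z ≤ K * p x₀ z) {u v c : I → ℝ} {A ρ : ℝ} (hu : ∀ i, 0 ≤ u i)
    (hu1 : ∑ i, u i = 1) (hv : ∀ i, 0 ≤ v i) (hv1 : ∑ i, v i = 1) (hA : 0 ≤ A)
    (hc : ∀ i, c i ∈ Set.Icc 0 A) (hcard : Fintype.card 𝒳 * A ≤ 1 / 2)
    (hmoment : ∀ k < κ, ∑ i, (u i - v i) * c i ^ k = 0) (hρ : ρ ≤ 1 / 2)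
    (h : Real.exp 1 * n * (4 * K * A ^ 2) ≤ ρ * κ) {φ : (Fin n → β) → ℝ} (hφ : ∀ y, |φ y| ≤ 1) :
    |prodExpect (fun _ : 𝒳 => u)
        (fun l => prodExpect (fun _ z => ∑ x, inputDist x₀ (c ∘ l) x * p x z) φ) -
      prodExpect (fun _ : 𝒳 => v)
        (fun l => prodExpect (fun _ z => ∑ x, inputDist x₀ (c ∘ l) x * p x z) φ)| ≤
      Fintype.card 𝒳 * √(8 * ρ ^ κ) := by
  have htv : ∑ i, |u i - v i| ≤ 2 := by
    calc ∑ i, |u i - v i| ≤ ∑ i, (u i + v i) := Finset.sum_le_sum fun i _ =>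
          abs_sub_le_iff.2 ⟨by linarith [hv i], by linarith [hu i]⟩
      _ = 2 := by rw [Finset.sum_add_distrib, hu1, hv1]; norm_num
  refine abs_prodExpect_sub_prodExpect_le hu hu1 hv hv1 fun m l => ?_
  simp only [Function.comp_update]
  exact abs_sum_mul_prodExpect_inputDist_update_le hκ hp hp1 hp₀ hpK htv hA
    (fun i => by rw [abs_of_nonneg (hc i).1]; exact (hc i).2) hmoment hρ h hφ
    (fun x => (hc (l x)).1) (sum_le_of_forall_le (fun x => (hc (l x)).2) hcard) m

/-- The probability of the dataset `X` when every element `m` first draws a random intensity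
`c (l m)`, with `l m` distributed as `u`, and the users then draw independent inputs from
`inputDist x₀ (c ∘ l)`. -/
noncomputable def datasetWeight (x₀ : 𝒳) (c u : I → ℝ) {n : ℕ} (X : Fin n → 𝒳) : ℝ :=
  prodExpect (fun _ : 𝒳 => u) fun l => ∏ j, inputDist x₀ (c ∘ l) (X j)

theorem sum_datasetWeight_mul (x₀ : 𝒳) (c u : I → ℝ) {n : ℕ} (f : (Fin n → 𝒳) → ℝ) :
    ∑ X, datasetWeight x₀ c u X * f X =
      prodExpect (fun _ : 𝒳 => u) fun l => prodExpect (fun _ => inputDist x₀ (c ∘ l)) f := by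
  simp only [datasetWeight, prodExpect, Finset.mul_sum, Finset.sum_mul, mul_assoc]
  exact Finset.sum_comm

theorem datasetWeight_nonneg {c u : I → ℝ} {A : ℝ} (hu : ∀ i, 0 ≤ u i)
    (hc : ∀ i, c i ∈ Set.Icc 0 A) (hcard : Fintype.card 𝒳 * A ≤ 1) (x₀ : 𝒳) {n : ℕ}
    (X : Fin n → 𝒳) : 0 ≤ datasetWeight x₀ c u X :=
  Finset.sum_nonneg fun l _ => mul_nonneg (Finset.prod_nonneg fun m _ => hu (l m)) <|
    Finset.prod_nonneg fun j _ => inputDist_nonneg (fun x => (hc (l x)).1)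
      (sum_le_of_forall_le (fun x => (hc (l x)).2) hcard) x₀ (X j)

theorem sum_datasetWeight {u : I → ℝ} (hu1 : ∑ i, u i = 1) (x₀ : 𝒳) (c : I → ℝ) (n : ℕ) :
    ∑ X : Fin n → 𝒳, datasetWeight x₀ c u X = 1 := by
  have h := sum_datasetWeight_mul x₀ c u fun _ : Fin n → 𝒳 => 1
  simp only [mul_one] at h
  simp only [h, prodExpect_const fun _ : Fin n => sum_inputDist x₀ _, prodExpect_const fun _ => hu1]

end RandomDataset

section ExpectedCount

variable {I : Type*} [Fintype I] {D n : ℕ}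

theorem prodExpect_countDistinct_le {a : Fin D → ℝ} (ha : ∀ x, 0 ≤ a x) (ha1 : ∑ x, a x ≤ 1)
    (x₀ : Fin D) :
    prodExpect (fun _ : Fin n => inputDist x₀ a) (fun X => (countDistinct X : ℝ)) ≤
      1 + ∑ x, if a x = 0 then 0 else 1 := by
  calc prodExpect (fun _ : Fin n => inputDist x₀ a) (fun X => (countDistinct X : ℝ))
      ≤ prodExpect (fun _ : Fin n => inputDist x₀ a)
          (fun _ => 1 + ∑ x, if a x = 0 then 0 else 1) := Finset.sum_le_sum fun X _ => ?_
    _ = 1 + ∑ x, if a x = 0 then 0 else 1 := prodExpect_const (fun _ => sum_inputDist x₀ a) _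
  rcases eq_or_ne (∏ j, inputDist x₀ a (X j)) 0 with h0 | h0
  · rw [h0, zero_mul, zero_mul]
  refine mul_le_mul_of_nonneg_left ?_
    (Finset.prod_nonneg fun j _ => inputDist_nonneg ha ha1 x₀ (X j))
  have himage : Finset.univ.image X ⊆ insert x₀ (Finset.univ.filter fun x => ¬a x = 0) := by
    refine Finset.image_subset_iff.2 fun j _ => ?_
    have hj := Finset.prod_ne_zero_iff.1 h0 j (Finset.mem_univ j)
    rcases eq_or_ne (X j) x₀ with h | h
    · exact Finset.mem_insert.2 (Or.inl h)
    · rw [inputDist, if_neg h, add_zero] at hj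
      exact Finset.mem_insert_of_mem (Finset.mem_filter.2 ⟨Finset.mem_univ _, hj⟩)
  have hcard := (Finset.card_le_card himage).trans (Finset.card_insert_le _ _)
  calc (countDistinct X : ℝ) ≤ (Finset.univ.filter fun x => ¬a x = 0).card + 1 :=
        mod_cast hcard
    _ = 1 + ∑ x, if a x = 0 then 0 else 1 := by
        rw [← Finset.sum_boole, add_comm]
        simp only [ite_not]

theorem sum_datasetWeight_mul_countDistinct_le {u c : I → ℝ} {A : ℝ} (hu : ∀ i, 0 ≤ u i)
    (hu1 : ∑ i, u i = 1) (hc : ∀ i, c i ∈ Set.Icc 0 A) (hcard : D * A ≤ 1) {i₀ : I}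
    (hi₀ : c i₀ = 0) (x₀ : Fin D) :
    ∑ X : Fin n → Fin D, datasetWeight x₀ c u X * countDistinct X ≤ 1 + D * (1 - u i₀) := by
  have hocc : ∑ i, u i * (if c i = 0 then 0 else 1) ≤ 1 - u i₀ := by
    classical
    calc ∑ i, u i * (if c i = 0 then 0 else 1) ≤ ∑ i, (u i - if i = i₀ then u i else 0) := by
          refine Finset.sum_le_sum fun i _ => ?_
          rcases eq_or_ne i i₀ with rfl | hi
          · simp [hi₀]
          · split_ifs <;> simp [hu i]
      _ = 1 - u i₀ := by simp [hu1]
  rw [sum_datasetWeight_mul]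
  calc prodExpect (fun _ => u) (fun l => prodExpect (fun _ => inputDist x₀ (c ∘ l)) _)
      ≤ prodExpect (fun _ : Fin D => u) (fun l => 1 + ∑ x, if c (l x) = 0 then 0 else 1) :=
        prodExpect_mono (fun _ => hu) fun l => prodExpect_countDistinct_le
          (fun x => (hc (l x)).1)
          (sum_le_of_forall_le (fun x => (hc (l x)).2) (by rwa [Fintype.card_fin])) x₀
    _ = 1 + ∑ _x : Fin D, ∑ i, u i * (if c i = 0 then 0 else 1) := by
        rw [prodExpect_add, prodExpect_const fun _ => hu1, prodExpect_sum]
        simp only [prodExpect_apply_eval (fun _ => hu1) _ fun i => if c i = 0 then (0 : ℝ) else 1]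
    _ ≤ 1 + D * (1 - u i₀) := by
        rw [Finset.sum_const, Finset.card_univ, Fintype.card_fin, nsmul_eq_mul]
        gcongr

theorem sub_countDistinct_eq_sum (X : Fin n → Fin D) :
    (D : ℝ) - countDistinct X = ∑ x, ∏ j, if X j = x then (0 : ℝ) else 1 := by
  have hcompl : (D : ℝ) - countDistinct X = ((Finset.univ.image X)ᶜ).card := by
    rw [Finset.card_compl, Fintype.card_fin, countDistinct,
      Nat.cast_sub ((Finset.card_le_univ _).trans_eq (Fintype.card_fin D))]
  rw [hcompl, ← Finset.filter_univ_mem (Finset.univ.image X)ᶜ, ← Finset.sum_boole]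
  refine Finset.sum_congr rfl fun x _ => ?_
  simp only [← ite_not (_ = x) (1 : ℝ) 0, Finset.prod_boole]
  congr 1
  simp

theorem one_sub_pow_le_exp {a p : ℝ} (hap : a ≤ p) (hp : p ≤ 1) (n : ℕ) :
    (1 - p) ^ n ≤ Real.exp (-(n * a)) := by
  calc (1 - p) ^ n ≤ Real.exp (-a) ^ n :=
        pow_le_pow_left₀ (sub_nonneg.2 hp)
          ((sub_le_sub_left hap 1).trans (Real.one_sub_le_exp_neg a)) n
    _ = Real.exp (-(n * a)) := by rw [← Real.exp_nat_mul, mul_neg]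

theorem prodExpect_sub_countDistinct_le {a : Fin D → ℝ} (ha : ∀ x, 0 ≤ a x)
    (ha1 : ∑ x, a x ≤ 1) (x₀ : Fin D) :
    prodExpect (fun _ : Fin n => inputDist x₀ a) (fun X => (D : ℝ) - countDistinct X) ≤
      ∑ x, Real.exp (-(n * a x)) := by
  simp only [sub_countDistinct_eq_sum, prodExpect_sum]
  refine Finset.sum_le_sum fun x _ => ?_
  have hmiss : ∑ z, inputDist x₀ a z * (if z = x then 0 else 1) = 1 - inputDist x₀ a x := by
    calc ∑ z, inputDist x₀ a z * (if z = x then 0 else 1)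
        = ∑ z, (inputDist x₀ a z - if z = x then inputDist x₀ a z else 0) :=
          Finset.sum_congr rfl fun z _ => by split_ifs <;> simp
      _ = 1 - inputDist x₀ a x := by simp [sum_inputDist]
  have hle_one : inputDist x₀ a x ≤ 1 := sum_inputDist x₀ a ▸
    Finset.single_le_sum (fun z _ => inputDist_nonneg ha ha1 x₀ z) (Finset.mem_univ x)
  rw [prodExpect_prod (fun _ => inputDist x₀ a) fun _ z => if z = x then (0 : ℝ) else 1, hmiss,
    Finset.prod_const, Finset.card_univ, Fintype.card_fin]
  exact one_sub_pow_le_exp (le_inputDist ha1 x₀ x) hle_one n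

theorem sum_datasetWeight_mul_sub_countDistinct_le {v c : I → ℝ} {A : ℝ} (hv : ∀ i, 0 ≤ v i)
    (hv1 : ∑ i, v i = 1) (hc : ∀ i, c i ∈ Set.Icc 0 A) (hcard : D * A ≤ 1) {b : ℝ}
    (hb : ∀ i, v i ≠ 0 → b ≤ n * c i) (x₀ : Fin D) :
    ∑ X : Fin n → Fin D, datasetWeight x₀ c v X * (D - countDistinct X) ≤
      D * Real.exp (-b) := by
  have hexp : ∑ i, v i * Real.exp (-(n * c i)) ≤ Real.exp (-b) := by
    calc ∑ i, v i * Real.exp (-(n * c i)) ≤ ∑ i, v i * Real.exp (-b) := by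
          refine Finset.sum_le_sum fun i _ => ?_
          rcases eq_or_ne (v i) 0 with h0 | h0
          · rw [h0, zero_mul, zero_mul]
          · exact mul_le_mul_of_nonneg_left (Real.exp_le_exp.2 (neg_le_neg (hb i h0))) (hv i)
      _ = Real.exp (-b) := by rw [← Finset.sum_mul, hv1, one_mul]
  rw [sum_datasetWeight_mul]
  calc prodExpect (fun _ => v) (fun l => prodExpect (fun _ => inputDist x₀ (c ∘ l)) _)
      ≤ prodExpect (fun _ : Fin D => v) (fun l => ∑ x, Real.exp (-(n * c (l x)))) :=
        prodExpect_mono (fun _ => hv) fun l => prodExpect_sub_countDistinct_le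
          (fun x => (hc (l x)).1)
          (sum_le_of_forall_le (fun x => (hc (l x)).2) (by rwa [Fintype.card_fin])) x₀
    _ = ∑ _x : Fin D, ∑ i, v i * Real.exp (-(n * c i)) := by
        rw [prodExpect_sum]
        simp only [prodExpect_apply_eval (fun _ => hv1) _ fun i => Real.exp (-(n * c i))]
    _ ≤ D * Real.exp (-b) := by
        rw [Finset.sum_const, Finset.card_univ, Fintype.card_fin, nsmul_eq_mul]
        gcongr

end ExpectedCount

section Expectation

open scoped ENNReal

variable {α β : Type*}

/-- The expectation of a nonnegative function on a discrete probability space. -/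
noncomputable def expect (P : PMF α) (f : α → ℝ≥0∞) : ℝ≥0∞ := ∑' x, P x * f x

theorem expect_bind (P : PMF α) (k : α → PMF β) (f : β → ℝ≥0∞) :
    expect (P.bind k) f = expect P fun x => expect (k x) f := by
  simp only [expect, PMF.bind_apply, ← ENNReal.tsum_mul_right, ← ENNReal.tsum_mul_left]
  rw [ENNReal.tsum_comm]
  simp only [mul_assoc]

theorem expect_pure (a : α) (f : α → ℝ≥0∞) : expect (PMF.pure a) f = f a := by
  rw [expect, tsum_eq_single a fun b hb => by rw [PMF.pure_apply, if_neg hb, zero_mul],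
    PMF.pure_apply, if_pos rfl, one_mul]

theorem expect_map (P : PMF α) (g : α → β) (f : β → ℝ≥0∞) :
    expect (P.map g) f = expect P fun x => f (g x) := by
  rw [PMF.map, expect_bind]
  simp only [Function.comp_apply, expect_pure]

theorem expect_mono (P : PMF α) {f g : α → ℝ≥0∞} (h : ∀ x ∈ P.support, f x ≤ g x) :
    expect P f ≤ expect P g := by
  refine ENNReal.tsum_le_tsum fun x => ?_
  by_cases hx : x ∈ P.support
  · exact mul_le_mul_right (h x hx) _
  · rw [(P.apply_eq_zero_iff x).2 hx, zero_mul, zero_mul]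

theorem expect_congr (P : PMF α) {f g : α → ℝ≥0∞} (h : ∀ x ∈ P.support, f x = g x) :
    expect P f = expect P g :=
  (expect_mono P fun x hx => (h x hx).le).antisymm (expect_mono P fun x hx => (h x hx).ge)

theorem expect_const (P : PMF α) (c : ℝ≥0∞) : (expect P fun _ => c) = c := by
  rw [expect, ENNReal.tsum_mul_right, P.tsum_coe, one_mul]

theorem expect_add (P : PMF α) (f g : α → ℝ≥0∞) :
    (expect P fun x => f x + g x) = expect P f + expect P g := by
  simp only [expect, mul_add, ENNReal.tsum_add]

theorem expect_mul_left (P : PMF α) (c : ℝ≥0∞) (f : α → ℝ≥0∞) :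
    (expect P fun x => c * f x) = c * expect P f := by
  simp only [expect, ← ENNReal.tsum_mul_left, mul_left_comm]

theorem expect_le_one (P : PMF α) {f : α → ℝ≥0∞} (h : ∀ x, f x ≤ 1) : expect P f ≤ 1 :=
  (expect_mono P fun x _ => h x).trans (expect_const P 1).le

theorem expect_ne_top (P : PMF α) {f : α → ℝ≥0∞} (h : ∀ x, f x ≤ 1) : expect P f ≠ ∞ :=
  ne_top_of_le_ne_top ENNReal.one_ne_top (expect_le_one P h)

theorem toReal_expect_one_sub (P : PMF α) {f : α → ℝ≥0∞} (h : ∀ x, f x ≤ 1) :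
    (expect P fun x => 1 - f x).toReal = 1 - (expect P f).toReal := by
  have hadd := expect_add P f fun x => 1 - f x
  simp only [add_tsub_cancel_of_le (h _), expect_const] at hadd
  rw [eq_sub_iff_add_eq', ← ENNReal.toReal_add (expect_ne_top P h)
    (expect_ne_top P fun x => tsub_le_self), ← hadd, ENNReal.toReal_one]

theorem toOuterMeasure_eq_expect (P : PMF α) (S : Set α) :
    P.toOuterMeasure S = expect P (S.indicator 1) := by
  rw [PMF.toOuterMeasure_apply, expect]
  refine tsum_congr fun x => ?_
  by_cases hx : x ∈ S <;> simp [hx]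

open Classical in
theorem expect_ite_mem (P : PMF α) (S : Set α) (a b : ℝ≥0∞) :
    (expect P fun x => if x ∈ S then a else b) =
      P.toOuterMeasure S * a + P.toOuterMeasure Sᶜ * b := by
  rw [toOuterMeasure_eq_expect, toOuterMeasure_eq_expect, mul_comm _ a, mul_comm _ b,
    ← expect_mul_left, ← expect_mul_left, ← expect_add]
  congr 1
  funext x
  by_cases hx : x ∈ S <;> simp [hx]

theorem toOuterMeasure_add_compl (P : PMF α) (S : Set α) :
    P.toOuterMeasure S + P.toOuterMeasure Sᶜ = 1 := by
  classical
  simpa only [ite_self, expect_const, mul_one] using (expect_ite_mem P S 1 1).symm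

theorem toOuterMeasure_le_one (P : PMF α) (S : Set α) : P.toOuterMeasure S ≤ 1 :=
  le_self_add.trans_eq (toOuterMeasure_add_compl P S)

theorem toOuterMeasure_ne_top (P : PMF α) (S : Set α) : P.toOuterMeasure S ≠ ∞ :=
  ne_top_of_le_ne_top ENNReal.one_ne_top (toOuterMeasure_le_one P S)

/-- The distribution `P` is dominated by `K` times the distribution `Q` up to additive error `η`.
Differential privacy says that output distributions on neighboring datasets dominate one another
with `K = exp ε`. -/
def IsDominated (P Q : PMF α) (K η : ℝ) : Prop :=
  ∀ S : Set α, P.toOuterMeasure S ≤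
    ENNReal.ofReal K * Q.toOuterMeasure S + ENNReal.ofReal η

theorem IsDominated.map {P Q : PMF α} {K η : ℝ} (h : IsDominated P Q K η) (g : α → β) :
    IsDominated (P.map g) (Q.map g) K η := fun S => by
  simpa only [PMF.toOuterMeasure_map_apply] using h (g ⁻¹' S)

theorem IsDominated.apply_le {P Q : PMF α} {K η : ℝ} (h : IsDominated P Q K η) (a : α) :
    P a ≤ ENNReal.ofReal K * Q a + ENNReal.ofReal η := by
  simpa only [PMF.toOuterMeasure_apply_singleton] using h {a}

theorem isDominated_of_toReal_le_or {P Q : PMF α} {K η : ℝ} (hK : 0 ≤ K)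
    (h : ∀ S, (P.toOuterMeasure S).toReal ≤ K * (Q.toOuterMeasure S).toReal ∨
      (P.toOuterMeasure S).toReal ≤ η) : IsDominated P Q K η := fun S => by
  rw [← ENNReal.ofReal_toReal (toOuterMeasure_ne_top P S)]
  rcases h S with h | h
  · refine le_add_of_le_of_nonneg ((ENNReal.ofReal_le_ofReal h).trans_eq ?_) zero_le
    rw [ENNReal.ofReal_mul hK, ENNReal.ofReal_toReal (toOuterMeasure_ne_top Q S)]
  · exact le_add_of_nonneg_of_le zero_le (ENNReal.ofReal_le_ofReal h)

end Expectation

section CountingUsers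

open scoped ENNReal

variable {Msg 𝒳 : Type*}

/-- The messages that reach the analyzer, for a fixed public random string. -/
noncomputable def shuffledMessages {n : ℕ} (R : 𝒳 → PMF (List Msg)) (X : Fin n → 𝒳) :
    PMF (List Msg) :=
  (concatMessages R (List.ofFn X)).bind shuffler

theorem map_shuffler_of_perm_invariant {γ : Type*} {g : List Msg → γ}
    (hg : ∀ l l', l.Perm l' → g l = g l') (l : List Msg) :
    (shuffler l).map g = PMF.pure (g l) := by
  have hperm (σ : Equiv.Perm (Fin l.length)) : (List.ofFn fun i => l.get (σ i)).Perm l :=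
    (Equiv.Perm.ofFn_comp_perm σ l.get).trans (by rw [List.ofFn_get])
  rw [shuffler, PMF.map_comp]
  simp only [Function.comp_def, hg _ _ (hperm _)]
  exact PMF.map_const _ _

open Classical in
/-- The number of users whose message sequence lies in `E`, recovered from the shuffled messages
`l` of `k` users who each send at most one message. A user without a message leaves no trace in
`l`, so such users are counted by `k - l.length`. -/
noncomputable def countUsers (E : Set (List Msg)) (k : ℕ) (l : List Msg) : ℕ :=
  l.countP (fun m => [m] ∈ E) + if [] ∈ E then k - l.length else 0

theorem countUsers_congr_perm (E : Set (List Msg)) (k : ℕ) (l l' : List Msg) (h : l.Perm l') :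
    countUsers E k l = countUsers E k l' := by
  rw [countUsers, countUsers, h.countP_eq, h.length_eq]

open Classical in
theorem countUsers_append (E : Set (List Msg)) {k : ℕ} {y ys : List Msg} (hy : y.length ≤ 1)
    (hys : ys.length ≤ k) :
    countUsers E (k + 1) (y ++ ys) = countUsers E k ys + if y ∈ E then 1 else 0 := by
  match y, hy with
  | [], _ =>
    simp only [countUsers, List.nil_append]
    split_ifs <;> omega
  | [m], _ =>
    simp only [countUsers, List.cons_append, List.nil_append, List.countP_cons, List.length_cons,
      decide_eq_true_eq]
    split_ifs <;> omega

theorem length_le_of_mem_support_concatMessages {R : 𝒳 → PMF (List Msg)}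
    (hR : ∀ x, ∀ l ∈ (R x).support, l.length ≤ 1) (xs : List 𝒳) :
    ∀ l ∈ (concatMessages R xs).support, l.length ≤ xs.length := by
  induction xs with
  | nil =>
    intro l hl
    rw [(PMF.mem_support_pure_iff _ _).1 hl]
    exact le_rfl
  | cons x xs ih =>
    intro l hl
    simp only [concatMessages, PMF.mem_support_bind_iff, PMF.mem_support_map_iff] at hl
    obtain ⟨y, hy, ys, hys, rfl⟩ := hl
    rw [List.length_append, List.length_cons, add_comm]
    exact add_le_add (ih ys hys) (hR x y hy)

theorem expect_concatMessages_cons (R : 𝒳 → PMF (List Msg)) (x : 𝒳) (xs : List 𝒳)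
    (f : List Msg → ℝ≥0∞) : expect (concatMessages R (x :: xs)) f =
      expect (R x) fun y => expect (concatMessages R xs) fun ys => f (y ++ ys) := by
  simp only [concatMessages, expect_bind, expect_map]

/-- The distribution of the number of users whose message sequence lies in `E`. -/
noncomputable def countLaw (R : 𝒳 → PMF (List Msg)) (E : Set (List Msg)) (xs : List 𝒳) : PMF ℕ :=
  (concatMessages R xs).map (countUsers E xs.length)

theorem map_countUsers_shuffledMessages {n : ℕ} (R : 𝒳 → PMF (List Msg)) (E : Set (List Msg))
    (X : Fin n → 𝒳) :
    (shuffledMessages R X).map (countUsers E n) = countLaw R E (List.ofFn X) := by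
  simp only [shuffledMessages, countLaw, PMF.map_bind, List.length_ofFn,
    map_shuffler_of_perm_invariant (countUsers_congr_perm E n)]
  rfl

theorem expect_countLaw_cons {R : 𝒳 → PMF (List Msg)}
    (hR : ∀ x, ∀ l ∈ (R x).support, l.length ≤ 1) (E : Set (List Msg)) (x : 𝒳) (xs : List 𝒳)
    (f : ℕ → ℝ≥0∞) : expect (countLaw R E (x :: xs)) f =
      (R x).toOuterMeasure E * expect (countLaw R E xs) (fun t => f (t + 1)) +
        (R x).toOuterMeasure Eᶜ * expect (countLaw R E xs) f := by
  classical
  rw [← expect_ite_mem, countLaw, expect_map, expect_concatMessages_cons]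
  refine expect_congr _ fun y hy => ?_
  have hcount (ys : List Msg) (hys : ys ∈ (concatMessages R xs).support) :=
    countUsers_append E (hR x y hy) (length_le_of_mem_support_concatMessages hR xs ys hys)
  simp only [countLaw, expect_map]
  split_ifs with hyE <;> refine expect_congr _ fun ys hys => ?_ <;>
    simp only [List.length_cons, hcount ys hys, hyE, if_true, if_false, add_zero]

theorem countLaw_cons_zero {R : 𝒳 → PMF (List Msg)}
    (hR : ∀ x, ∀ l ∈ (R x).support, l.length ≤ 1) (E : Set (List Msg)) (x : 𝒳) (xs : List 𝒳) :
    countLaw R E (x :: xs) 0 = (R x).toOuterMeasure Eᶜ * countLaw R E xs 0 := by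
  simpa [expect] using expect_countLaw_cons hR E x xs fun k => if k = 0 then 1 else 0

theorem countLaw_cons_succ {R : 𝒳 → PMF (List Msg)}
    (hR : ∀ x, ∀ l ∈ (R x).support, l.length ≤ 1) (E : Set (List Msg)) (x : 𝒳) (xs : List 𝒳)
    (t : ℕ) : countLaw R E (x :: xs) (t + 1) = (R x).toOuterMeasure E * countLaw R E xs t +
      (R x).toOuterMeasure Eᶜ * countLaw R E xs (t + 1) := by
  simpa [expect] using expect_countLaw_cons hR E x xs fun k => if k = t + 1 then 1 else 0

theorem countLaw_replicate {R : 𝒳 → PMF (List Msg)}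
    (hR : ∀ x, ∀ l ∈ (R x).support, l.length ≤ 1) (E : Set (List Msg)) (x : 𝒳) (m t : ℕ) :
    countLaw R E (List.replicate m x) t =
      m.choose t * (R x).toOuterMeasure E ^ t * (R x).toOuterMeasure Eᶜ ^ (m - t) := by
  induction m generalizing t with
  | zero => cases t <;> simp [countLaw, concatMessages, countUsers, PMF.pure_map, PMF.pure_apply]
  | succ m ih =>
    rw [List.replicate_succ]
    cases t with
    | zero => simp [countLaw_cons_zero hR, ih, pow_succ, mul_comm]
    | succ t =>
      rw [countLaw_cons_succ hR, ih, ih, Nat.choose_succ_succ, Nat.add_sub_add_right]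
      rcases Nat.lt_or_ge t m with h | h
      · rw [show m - t = m - (t + 1) + 1 by omega]
        push_cast
        ring
      · rw [Nat.choose_eq_zero_of_lt (show m < t + 1 by omega)]
        push_cast
        ring

theorem binomial_le_of_isDominated {R : 𝒳 → PMF (List Msg)}
    (hR : ∀ x, ∀ l ∈ (R x).support, l.length ≤ 1) {C δ : ℝ} (hC : 0 ≤ C) (hδ : 0 ≤ δ) {m : ℕ}
    {x₀ x : 𝒳} (h : IsDominated (shuffledMessages R (Fin.cons x fun _ : Fin m => x₀))
      (shuffledMessages R fun _ : Fin (m + 1) => x₀) C δ) (E : Set (List Msg)) {p q : ℝ}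
    (hp0 : 0 ≤ p) (hq0 : 0 ≤ q) (hq1 : q ≤ 1) (hp : (R x).toOuterMeasure E = ENNReal.ofReal p)
    (hq : (R x₀).toOuterMeasure E = ENNReal.ofReal q) (t : ℕ) :
    p * (m.choose t * q ^ t * (1 - q) ^ (m - t)) ≤
      C * ((m + 1).choose (t + 1) * q ^ (t + 1) * (1 - q) ^ (m - t)) + δ := by
  have h1q : 0 ≤ 1 - q := sub_nonneg.2 hq1
  have hqc : (R x₀).toOuterMeasure Eᶜ = ENNReal.ofReal (1 - q) := by
    rw [ENNReal.ofReal_sub _ hq0, ENNReal.ofReal_one, ← hq]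
    exact ENNReal.eq_sub_of_add_eq' ENNReal.one_ne_top
      ((add_comm _ _).trans (toOuterMeasure_add_compl (R x₀) E))
  have hcount := (h.map (countUsers E (m + 1))).apply_le (t + 1)
  rw [map_countUsers_shuffledMessages, map_countUsers_shuffledMessages, List.ofFn_const,
    countLaw_replicate hR, List.ofFn_cons, countLaw_cons_succ hR, List.ofFn_const,
    countLaw_replicate hR, hp, hq, hqc, Nat.add_sub_add_right] at hcount
  have hfirst := le_self_add.trans hcount
  rwa [← ENNReal.ofReal_natCast, ← ENNReal.ofReal_natCast, ← ENNReal.ofReal_pow hq0,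
    ← ENNReal.ofReal_pow h1q, ← ENNReal.ofReal_pow hq0, ← ENNReal.ofReal_mul (by positivity),
    ← ENNReal.ofReal_mul (by positivity), ← ENNReal.ofReal_mul (by positivity),
    ← ENNReal.ofReal_mul (by positivity), ← ENNReal.ofReal_mul (by positivity),
    ← ENNReal.ofReal_mul (by positivity), ← ENNReal.ofReal_add (by positivity) hδ,
    ENNReal.ofReal_le_ofReal_iff (by positivity)] at hfirst

end CountingUsers

section RandomizerDomination

open scoped ENNReal

theorem exp_neg_two_mul_le_one_sub {q : ℝ} (h0 : 0 ≤ q) (h : q ≤ 1 / 2) :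
    Real.exp (-(2 * q)) ≤ 1 - q := by
  rw [Real.exp_neg, inv_le_comm₀ (Real.exp_pos _) (by linarith)]
  refine le_trans ?_ (Real.add_one_le_exp (2 * q))
  rw [inv_le_iff_one_le_mul₀ (by linarith)]
  nlinarith

theorem div_exp_one_pow_le_binomial {a q : ℝ} {m t : ℕ} (ha : 0 ≤ a) (haq : a ≤ q) (htm : t ≤ m)
    (hq : 2 * (m + 1) * q ≤ t + 1) :
    (a / Real.exp 1) ^ (t + 1) ≤ m.choose t * q ^ t * (1 - q) ^ (m - t) := by
  have hq0 : 0 ≤ q := ha.trans haq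
  have hq_half : q ≤ 1 / 2 := by
    have : (t : ℝ) + 1 ≤ m + 1 := by gcongr
    nlinarith
  have hmiss : Real.exp (-(t + 1)) ≤ (1 - q) ^ (m - t) := by
    calc Real.exp (-(t + 1)) ≤ Real.exp (((m + 1 : ℕ) : ℝ) * (-(2 * q))) := by
          rw [Real.exp_le_exp]
          push_cast
          linarith
      _ = Real.exp (-(2 * q)) ^ (m + 1) := Real.exp_nat_mul _ _
      _ ≤ (1 - q) ^ (m + 1) :=
          pow_le_pow_left₀ (Real.exp_pos _).le (exp_neg_two_mul_le_one_sub hq0 hq_half) _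
      _ ≤ (1 - q) ^ (m - t) := pow_le_pow_of_le_one (by linarith) (by linarith) (by omega)
  have hhit : a ^ (t + 1) ≤ m.choose t * q ^ t := by
    calc a ^ (t + 1) ≤ q ^ (t + 1) := pow_le_pow_left₀ ha haq _
      _ ≤ q ^ t := pow_le_pow_of_le_one hq0 (by linarith) t.le_succ
      _ ≤ m.choose t * q ^ t :=
          le_mul_of_one_le_left (pow_nonneg hq0 t) (mod_cast Nat.choose_pos htm)
  calc (a / Real.exp 1) ^ (t + 1) = a ^ (t + 1) * Real.exp (-(t + 1)) := by
        rw [div_pow, ← Real.exp_nat_mul, mul_one, Real.exp_neg, div_eq_mul_inv]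
        push_cast
        rfl
    _ ≤ m.choose t * q ^ t * (1 - q) ^ (m - t) :=
        mul_le_mul hhit hmiss (Real.exp_pos _).le (by positivity)

theorem le_of_binomial_le_of_small {m : ℕ} {C p q η δ : ℝ} (hC : 1 ≤ C) (hq0 : 0 ≤ q)
    (hη1 : η ≤ 1)
    (h : p * (1 - q) ^ m ≤ C * ((m + 1) * q * (1 - q) ^ m) + δ)
    (hδ : 4 * δ ≤ η) (hq : C * (m + 1) * q ≤ η / 4) : p ≤ η := by
  have hmq : (m + 1) * q ≤ 1 / 4 := by
    have : 0 ≤ (m + 1) * q := by positivity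
    nlinarith
  have hhalf : 1 / 2 ≤ (1 - q) ^ m := by
    have := one_add_mul_le_pow (show (-2 : ℝ) ≤ -q by nlinarith) m
    rw [← sub_eq_add_neg] at this
    nlinarith
  have hη0 : 0 ≤ η := by
    have : 0 ≤ C * (m + 1) * q := by positivity
    linarith
  have hmain := mul_le_mul_of_nonneg_right hq (show 0 ≤ (1 - q) ^ m by linarith)
  have hslack := mul_le_mul_of_nonneg_left hhalf hη0
  refine le_of_mul_le_mul_right ?_ (show 0 < (1 - q) ^ m by linarith)
  linarith

theorem le_of_binomial_le_of_large {m t : ℕ} {C p q η δ : ℝ} (htm : t ≤ m) (hC : 1 ≤ C)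
    (hp1 : p ≤ 1) (hη0 : 0 < η)
    (h : p * (m.choose t * q ^ t * (1 - q) ^ (m - t)) ≤
      C * ((m + 1).choose (t + 1) * q ^ (t + 1) * (1 - q) ^ (m - t)) + δ)
    (hpq : 2 * C * (m + 1) / (t + 1) * q ≤ p)
    (hδ : 2 * δ ≤ η * (η / (4 * C * (m + 1) * Real.exp 1)) ^ (t + 1))
    (hq : η / 4 ≤ C * (m + 1) * q) : p ≤ η := by
  set b : ℝ := m.choose t * q ^ t * (1 - q) ^ (m - t) with hb
  have haq : η / (4 * C * (m + 1)) ≤ q := by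
    rw [div_le_iff₀ (by positivity)]
    linarith
  have hqT : 2 * (m + 1) * q ≤ t + 1 := by
    rw [div_mul_eq_mul_div, div_le_iff₀ (by positivity)] at hpq
    have : 0 ≤ (m + 1) * q := mul_nonneg (by positivity) (le_trans (by positivity) haq)
    nlinarith
  have hlower : (η / (4 * C * (m + 1) * Real.exp 1)) ^ (t + 1) ≤ b := by
    rw [← div_div]
    exact div_exp_one_pow_le_binomial (by positivity) haq htm hqT
  have hb_pos : 0 < b := lt_of_lt_of_le (by positivity) hlower
  have hshift : C * ((m + 1).choose (t + 1) * q ^ (t + 1) * (1 - q) ^ (m - t)) =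
      (2 * C * (m + 1) / (t + 1) * q) / 2 * b := by
    have hchoose : ((m + 1).choose (t + 1) : ℝ) = (m + 1) / (t + 1) * m.choose t := by
      rw [div_mul_eq_mul_div, eq_div_iff (by positivity)]
      exact_mod_cast (Nat.add_one_mul_choose_eq m t).symm
    rw [hchoose, hb]
    ring
  rw [hshift] at h
  have hpb : p * b ≤ η * b := by
    have := mul_le_mul_of_nonneg_right hpq hb_pos.le
    have := mul_le_mul_of_nonneg_left hlower hη0.le
    linarith
  exact le_of_mul_le_mul_right hpb hb_pos

/-- A user with input `x` hits a set of randomizer outcomes with probability `p`, the others hit it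
with probability `q`. If `q` is tiny, a single hit reveals the first user; otherwise, `T` hits are
still rare but happen with probability more than `δ`, and they reveal the first user as soon as
`p` is much larger than `n q / T`. -/
theorem isDominated_randomizer {Msg 𝒳 : Type*} {R : 𝒳 → PMF (List Msg)}
    (hR : ∀ x, ∀ l ∈ (R x).support, l.length ≤ 1) {C η δ : ℝ} {m t : ℕ} (hC : 1 ≤ C)
    (htm : t ≤ m) (hη0 : 0 < η) (hη1 : η ≤ 1) (hδ0 : 0 ≤ δ) (hδ : 4 * δ ≤ η)
    (hδt : 2 * δ ≤ η * (η / (4 * C * (m + 1) * Real.exp 1)) ^ (t + 1)) {x₀ x : 𝒳}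
    (h : IsDominated (shuffledMessages R (Fin.cons x fun _ : Fin m => x₀))
      (shuffledMessages R fun _ : Fin (m + 1) => x₀) C δ) :
    IsDominated (R x) (R x₀) (2 * C * (m + 1) / (t + 1)) η := by
  refine isDominated_of_toReal_le_or (by positivity) fun E => ?_
  have hle_one (z : 𝒳) : ((R z).toOuterMeasure E).toReal ≤ 1 := by
    simpa using ENNReal.toReal_mono ENNReal.one_ne_top (toOuterMeasure_le_one (R z) E)
  have hbinomial := binomial_le_of_isDominated hR (by linarith) hδ0 h E ENNReal.toReal_nonneg
    ENNReal.toReal_nonneg (hle_one x₀) (ENNReal.ofReal_toReal (toOuterMeasure_ne_top _ _)).symm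
    (ENNReal.ofReal_toReal (toOuterMeasure_ne_top _ _)).symm
  set p := ((R x).toOuterMeasure E).toReal
  set q := ((R x₀).toOuterMeasure E).toReal
  refine (le_total p _).imp_right fun hpq => ?_
  rcases le_total (C * (m + 1) * q) (η / 4) with hq | hq
  · refine le_of_binomial_le_of_small hC ENNReal.toReal_nonneg hη1 ?_ hδ hq
    simpa using hbinomial 0
  · exact le_of_binomial_le_of_large htm hC (hle_one x) hη0 (hbinomial t) hpq hδt hq

end RandomizerDomination

section FiniteApproximation

open scoped ENNReal

variable {α β Msg 𝒳 : Type*}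

/-- Probability densities `prob x` on a common finite set of outcomes that are within `τ` of the
distributions `R x` in total variation. This is witnessed by sub-probability densities `common x`
of mass at least `1 - τ` that lie below both. -/
structure FiniteApprox (R : 𝒳 → PMF α) (τ : ℝ) where
  outcomes : Finset α
  common : 𝒳 → outcomes → ℝ
  prob : 𝒳 → outcomes → ℝ
  common_nonneg : ∀ x z, 0 ≤ common x z
  ofReal_common_le : ∀ x (z : outcomes), ENNReal.ofReal (common x z) ≤ R x z
  common_le_prob : ∀ x z, common x z ≤ prob x z
  sum_prob : ∀ x, ∑ z, prob x z = 1
  le_sum_common : ∀ x, 1 - τ ≤ ∑ z, common x z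

theorem sum_prod_mul_le_expect_concatMessages {R : 𝒳 → PMF (List Msg)} {F : Finset (List Msg)}
    {s : 𝒳 → F → ℝ≥0∞} (hs : ∀ x (z : F), s x z ≤ R x z) {n : ℕ} (X : Fin n → 𝒳)
    (g : List Msg → ℝ≥0∞) :
    ∑ y : Fin n → F, (∏ j, s (X j) (y j)) * g (List.ofFn fun j => (y j : List Msg)).flatten ≤
      expect (concatMessages R (List.ofFn X)) g := by
  induction n generalizing g with
  | zero => simp [concatMessages, expect_pure]
  | succ n ih =>
    rw [List.ofFn_succ, expect_concatMessages_cons, ← Equiv.sum_comp (Fin.consEquiv fun _ => F),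
      Fintype.sum_prod_type]
    calc _ = ∑ z : F, s (X 0) z * ∑ y : Fin n → F, (∏ j, s (X j.succ) (y j)) *
          g (z ++ (List.ofFn fun j => (y j : List Msg)).flatten) := by
          refine Finset.sum_congr rfl fun z _ => ?_
          rw [Finset.mul_sum]
          refine Finset.sum_congr rfl fun y _ => ?_
          simp [Fin.consEquiv, Fin.prod_univ_succ, List.ofFn_succ, mul_assoc]
      _ ≤ ∑ z : F, R (X 0) z *
          expect (concatMessages R (List.ofFn fun j => X j.succ)) fun ys => g (z ++ ys) :=
        Finset.sum_le_sum fun z _ => mul_le_mul' (hs _ _) (ih _ fun ys => g (z ++ ys))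
      _ ≤ _ := by
        rw [Finset.sum_coe_sort F fun z => R (X 0) z *
          expect (concatMessages R (List.ofFn fun j => X j.succ)) fun ys => g (z ++ ys)]
        exact ENNReal.sum_le_tsum F

namespace FiniteApprox

theorem prob_nonneg {R : 𝒳 → PMF α} {τ : ℝ} (A : FiniteApprox R τ) (x : 𝒳) (z : A.outcomes) :
    0 ≤ A.prob x z :=
  (A.common_nonneg x z).trans (A.common_le_prob x z)

variable {R : 𝒳 → PMF (List Msg)} {τ : ℝ} (A : FiniteApprox R τ) {n : ℕ}

/-- The expected value of `g` on the concatenated messages, computed with the approximation. -/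
noncomputable def approxExpect (X : Fin n → 𝒳) (g : List Msg → ℝ≥0∞) : ℝ :=
  prodExpect (fun j => A.prob (X j)) fun y =>
    (g (List.ofFn fun j => (y j : List Msg)).flatten).toReal

theorem prodExpect_common_le (X : Fin n → 𝒳) {g : List Msg → ℝ≥0∞} (hg : ∀ l, g l ≤ 1) :
    (prodExpect (fun j => A.common (X j)) fun y =>
      (g (List.ofFn fun j => (y j : List Msg)).flatten).toReal) ≤
        (expect (concatMessages R (List.ofFn X)) g).toReal := by
  have hprod_nonneg (y : Fin n → A.outcomes) : 0 ≤ ∏ j, A.common (X j) (y j) :=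
    Finset.prod_nonneg fun j _ => A.common_nonneg _ _
  rw [← ENNReal.ofReal_le_iff_le_toReal (expect_ne_top _ hg), prodExpect,
    ENNReal.ofReal_sum_of_nonneg fun y _ => mul_nonneg (hprod_nonneg y) ENNReal.toReal_nonneg]
  refine le_of_eq_of_le (Finset.sum_congr rfl fun y _ => ?_)
    (sum_prod_mul_le_expect_concatMessages A.ofReal_common_le X g)
  rw [ENNReal.ofReal_mul (hprod_nonneg y),
    ENNReal.ofReal_prod_of_nonneg fun j _ => A.common_nonneg _ _,
    ENNReal.ofReal_toReal (ne_top_of_le_ne_top ENNReal.one_ne_top (hg _))]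

theorem one_sub_mul_le_prodExpect_common (hτ : τ ≤ 1) (X : Fin n → 𝒳) :
    1 - n * τ ≤ prodExpect (fun j => A.common (X j)) fun _ => 1 := by
  have hprod := prodExpect_prod (fun j => A.common (X j)) fun _ _ => 1
  simp only [Finset.prod_const_one, mul_one] at hprod
  calc 1 - n * τ = 1 + n * -τ := by ring
    _ ≤ (1 + -τ) ^ n := one_add_mul_le_pow (by linarith) n
    _ = ∏ _j : Fin n, (1 - τ) := by simp [sub_eq_add_neg]
    _ ≤ ∏ j : Fin n, ∑ z, A.common (X j) z :=
        Finset.prod_le_prod (fun j _ => by linarith) fun j _ => A.le_sum_common _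
    _ = _ := hprod.symm

theorem abs_toReal_expect_sub_approxExpect_le (hτ : τ ≤ 1) (X : Fin n → 𝒳)
    {g : List Msg → ℝ≥0∞} (hg : ∀ l, g l ≤ 1) :
    |(expect (concatMessages R (List.ofFn X)) g).toReal - A.approxExpect X g| ≤ n * τ := by
  have hg_toReal (l : List Msg) : (1 - g l).toReal = 1 - (g l).toReal := by
    rw [ENNReal.toReal_sub_of_le (hg l) ENNReal.one_ne_top, ENNReal.toReal_one]
  have hle (f : List Msg → ℝ≥0∞) := prodExpect_mono_left
    (fun j => A.common_nonneg (X j)) (fun j => A.common_le_prob (X j))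
    (f := fun y => (f (List.ofFn fun j => (y j : List Msg)).flatten).toReal)
    fun _ => ENNReal.toReal_nonneg
  have hcommon := A.prodExpect_common_le X hg
  have hcommon_compl := A.prodExpect_common_le X (g := fun l => 1 - g l) fun _ => tsub_le_self
  have hprob := hle g
  have hprob_compl := hle fun l => 1 - g l
  simp only [hg_toReal, prodExpect_sub, prodExpect_const (fun j => A.sum_prob (X j)),
    toReal_expect_one_sub _ hg] at hcommon_compl hprob_compl
  have hmass := A.one_sub_mul_le_prodExpect_common hτ X
  rw [approxExpect, abs_le]
  constructor <;> linarith

end FiniteApprox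

theorem exists_finset_toOuterMeasure_compl_le (Q : PMF α) {η : ℝ} (hη : 0 < η) :
    ∃ F : Finset α, (∀ z ∈ F, Q z ≠ 0) ∧ Q.toOuterMeasure (F : Set α)ᶜ ≤ ENNReal.ofReal η := by
  classical
  obtain ⟨F, hF⟩ : ∃ F : Finset α, 1 < ∑ z ∈ F, Q z + ENNReal.ofReal η := by
    have hlt : 1 < (⨆ F : Finset α, ∑ z ∈ F, Q z) + ENNReal.ofReal η := by
      rw [← ENNReal.tsum_eq_iSup_sum, Q.tsum_coe]
      exact ENNReal.lt_add_right ENNReal.one_ne_top (by simpa using hη)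
    rw [ENNReal.iSup_add] at hlt
    exact lt_iSup_iff.1 hlt
  refine ⟨F.filter fun z => Q z ≠ 0, fun z hz => (Finset.mem_filter.1 hz).2, ?_⟩
  have hmass := toOuterMeasure_add_compl Q (F.filter fun z => Q z ≠ 0 : Finset α)
  rw [PMF.toOuterMeasure_apply_finset, Finset.sum_filter_ne_zero] at hmass
  rw [← hmass] at hF
  exact (lt_of_add_lt_add_left hF).le

/-- The part of the density of `P` that is dominated by `K` times the density of `Q`. -/
noncomputable def overlap (P Q : PMF α) (K : ℝ) (z : α) : ℝ :=
  (min (P z) (ENNReal.ofReal K * Q z)).toReal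

theorem overlap_nonneg (P Q : PMF α) (K : ℝ) (z : α) : 0 ≤ overlap P Q K z :=
  ENNReal.toReal_nonneg

theorem ofReal_overlap (P Q : PMF α) (K : ℝ) (z : α) :
    ENNReal.ofReal (overlap P Q K z) = min (P z) (ENNReal.ofReal K * Q z) :=
  ENNReal.ofReal_toReal (ne_top_of_le_ne_top (P.apply_ne_top z) (min_le_left _ _))

theorem ofReal_overlap_le (P Q : PMF α) (K : ℝ) (z : α) : ENNReal.ofReal (overlap P Q K z) ≤ P z :=
  (ofReal_overlap P Q K z).trans_le (min_le_left _ _)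

theorem overlap_self {K : ℝ} (hK : 1 ≤ K) (P : PMF α) (z : α) :
    overlap P P K z = (P z).toReal :=
  congrArg ENNReal.toReal (min_eq_left (le_mul_of_one_le_left' (ENNReal.one_le_ofReal.2 hK)))

theorem overlap_le_mul {K : ℝ} (hK : 0 ≤ K) (P Q : PMF α) (z : α) :
    overlap P Q K z ≤ K * (Q z).toReal := by
  have := ENNReal.toReal_mono (ENNReal.mul_ne_top ENNReal.ofReal_ne_top (Q.apply_ne_top z))
    (min_le_right (P z) (ENNReal.ofReal K * Q z))
  rwa [ENNReal.toReal_mul, ENNReal.toReal_ofReal hK] at this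

theorem ofReal_sum_overlap (P Q : PMF α) (K : ℝ) (F : Finset α) :
    ENNReal.ofReal (∑ z ∈ F, overlap P Q K z) = ∑ z ∈ F, min (P z) (ENNReal.ofReal K * Q z) := by
  simp only [ENNReal.ofReal_sum_of_nonneg fun z _ => overlap_nonneg P Q K z, ofReal_overlap]

theorem sum_overlap_le_one (P Q : PMF α) (K : ℝ) (F : Finset α) :
    ∑ z ∈ F, overlap P Q K z ≤ 1 := by
  rw [← ENNReal.ofReal_le_one, ofReal_sum_overlap, ← P.tsum_coe]
  exact (Finset.sum_le_sum fun z _ => min_le_left _ _).trans (ENNReal.sum_le_tsum F)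

theorem IsDominated.one_le_sum_min_add {P Q : PMF α} {K η : ℝ} (h : IsDominated P Q K η)
    (F : Finset α) :
    1 ≤ ∑ z ∈ F, min (P z) (ENNReal.ofReal K * Q z) +
      (ENNReal.ofReal K * Q.toOuterMeasure (F : Set α)ᶜ + ENNReal.ofReal η) := by
  classical
  set S : Set α := {z | ENNReal.ofReal K * Q z < P z} ∪ (F : Set α)ᶜ with hS
  have hpointwise (z : α) : Sᶜ.indicator P z + ENNReal.ofReal K * S.indicator Q z ≤
      (F : Set α).indicator (fun z => min (P z) (ENNReal.ofReal K * Q z)) z +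
        ENNReal.ofReal K * (F : Set α)ᶜ.indicator Q z := by
    by_cases hzF : z ∈ F
    · rcases lt_or_ge (ENNReal.ofReal K * Q z) (P z) with hz | hz
      · simp [hS, hzF, hz, hz.le]
      · simp [hS, hzF, hz, hz.not_gt]
    · simp [hS, hzF]
  have hsum := ENNReal.tsum_le_tsum hpointwise
  rw [ENNReal.tsum_add, ENNReal.tsum_add, ENNReal.tsum_mul_left, ENNReal.tsum_mul_left,
    ← PMF.toOuterMeasure_apply, ← PMF.toOuterMeasure_apply, ← PMF.toOuterMeasure_apply,
    ← sum_eq_tsum_indicator] at hsum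
  calc 1 = P.toOuterMeasure Sᶜ + P.toOuterMeasure S := by
        rw [add_comm, toOuterMeasure_add_compl]
    _ ≤ P.toOuterMeasure Sᶜ + (ENNReal.ofReal K * Q.toOuterMeasure S + ENNReal.ofReal η) := by
        gcongr
        exact h S
    _ ≤ _ := by
        rw [← add_assoc, ← add_assoc]
        gcongr

theorem IsDominated.le_sum_overlap {P Q : PMF α} {K η : ℝ} (h : IsDominated P Q K η)
    (hK : 0 < K) (hη : 0 ≤ η) {F : Finset α}
    (hF : Q.toOuterMeasure (F : Set α)ᶜ ≤ ENNReal.ofReal (η / K)) :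
    1 - η - η ≤ ∑ z ∈ F, overlap P Q K z := by
  have hmass := (h.one_le_sum_min_add F).trans
    (add_le_add_right (add_le_add_left (mul_le_mul_right hF _) _) _)
  rw [← ofReal_sum_overlap, ← ENNReal.ofReal_mul hK.le, mul_div_cancel₀ _ hK.ne',
    ← ENNReal.ofReal_add hη hη, ← ENNReal.ofReal_add
      (Finset.sum_nonneg fun z _ => overlap_nonneg P Q K z) (by positivity),
    ENNReal.one_le_ofReal] at hmass
  linarith

/-- The probability densities obtained from sub-probability densities `s x` by distributing the
missing mass proportionally to `s x₀`. -/
noncomputable def completion [Fintype β] (s : 𝒳 → β → ℝ) (x₀ x : 𝒳) (z : β) : ℝ :=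
  s x z + (1 - ∑ z', s x z') * (s x₀ z / ∑ z', s x₀ z')

section Completion

variable [Fintype β] {s : 𝒳 → β → ℝ} {x₀ : 𝒳}

theorem completion_self (h : 0 < ∑ z, s x₀ z) (z : β) :
    completion s x₀ x₀ z = s x₀ z / ∑ z', s x₀ z' := by
  rw [completion]
  field_simp
  ring

theorem sum_completion (h : 0 < ∑ z, s x₀ z) (x : 𝒳) : ∑ z, completion s x₀ x z = 1 := by
  simp only [completion]
  rw [Finset.sum_add_distrib, ← Finset.mul_sum, ← Finset.sum_div, div_self h.ne']
  ring

theorem le_completion (hs : ∀ x z, 0 ≤ s x z) (hs1 : ∀ x, ∑ z, s x z ≤ 1) (x : 𝒳) (z : β) :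
    s x z ≤ completion s x₀ x z :=
  le_add_of_nonneg_right (mul_nonneg (sub_nonneg.2 (hs1 x))
    (div_nonneg (hs _ _) (Finset.sum_nonneg fun _ _ => hs _ _)))

theorem completion_le_mul (hs : ∀ x z, 0 ≤ s x z) (hs1 : ∀ x, ∑ z, s x z ≤ 1)
    (h : 0 < ∑ z, s x₀ z) {K : ℝ} (hK : 0 ≤ K) {x : 𝒳} {z : β} (hsK : s x z ≤ K * s x₀ z) :
    completion s x₀ x z ≤ (K + 1) * completion s x₀ x₀ z := by
  have hle : s x z ≤ K * completion s x₀ x₀ z :=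
    hsK.trans (mul_le_mul_of_nonneg_left (le_completion hs hs1 x₀ z) hK)
  rw [completion, ← completion_self h, add_mul, one_mul]
  refine add_le_add hle (mul_le_of_le_one_left ((hs _ _).trans (le_completion hs hs1 _ _)) ?_)
  exact sub_le_self _ (Finset.sum_nonneg fun _ _ => hs _ _)

end Completion

theorem exists_finiteApprox {R : 𝒳 → PMF α} {x₀ : 𝒳} {K η : ℝ} (hK : 1 ≤ K) (hη0 : 0 < η)
    (hη : 2 * η < 1) (h : ∀ x, IsDominated (R x) (R x₀) K η) :
    ∃ A : FiniteApprox R (2 * η), (∀ z, 0 < A.prob x₀ z) ∧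
      ∀ x z, A.prob x z ≤ (K + 1) * A.prob x₀ z := by
  have hK0 : 0 < K := by linarith
  obtain ⟨F, hF_support, hF_compl⟩ :=
    exists_finset_toOuterMeasure_compl_le (R x₀) (div_pos hη0 hK0)
  let s (x : 𝒳) (z : F) : ℝ := overlap (R x) (R x₀) K z
  have hs_nonneg x z : 0 ≤ s x z := overlap_nonneg _ _ _ _
  have hs_sum_le x : ∑ z, s x z ≤ 1 :=
    (Finset.sum_coe_sort F _).trans_le (sum_overlap_le_one _ _ _ _)
  have hs_sum_ge x : 1 - 2 * η ≤ ∑ z, s x z := by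
    rw [two_mul, ← sub_sub]
    exact ((h x).le_sum_overlap hK0 hη0.le hF_compl).trans_eq (Finset.sum_coe_sort F _).symm
  have hs_sum_pos : 0 < ∑ z, s x₀ z := by linarith [hs_sum_ge x₀]
  have hs_self z : s x₀ z = (R x₀ z).toReal := overlap_self hK _ _
  have hs_dom x z : s x z ≤ K * s x₀ z := (hs_self z).symm ▸ overlap_le_mul hK0.le _ _ _
  refine ⟨⟨F, s, completion s x₀, hs_nonneg, fun x z => ofReal_overlap_le _ _ _ _,
    le_completion hs_nonneg hs_sum_le, sum_completion hs_sum_pos, hs_sum_ge⟩, fun z => ?_,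
    fun x z => completion_le_mul hs_nonneg hs_sum_le hs_sum_pos hK0.le (hs_dom x z)⟩
  refine lt_of_lt_of_le ?_ (le_completion hs_nonneg hs_sum_le x₀ z)
  rw [hs_self]
  exact ENNReal.toReal_pos (hF_support z z.2) ((R x₀).apply_ne_top _)

end FiniteApproximation

section Indistinguishability

open scoped ENNReal

variable {ι I Msg 𝒳 : Type*}

theorem abs_sum_mul_sub_sum_mul_le [Fintype ι] {w f g : ι → ℝ} {c : ℝ} (hw : ∀ i, 0 ≤ w i)
    (hw1 : ∑ i, w i = 1) (h : ∀ i, |f i - g i| ≤ c) :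
    |∑ i, w i * f i - ∑ i, w i * g i| ≤ c := by
  rw [← Finset.sum_sub_distrib]
  calc |∑ i, (w i * f i - w i * g i)| ≤ ∑ i, |w i * f i - w i * g i| :=
        Finset.abs_sum_le_sum_abs _ _
    _ ≤ ∑ i, w i * c := Finset.sum_le_sum fun i _ => by
        rw [← mul_sub, abs_mul, abs_of_nonneg (hw i)]
        exact mul_le_mul_of_nonneg_left (h i) (hw i)
    _ = c := by rw [← Finset.sum_mul, hw1, one_mul]

variable [Fintype I] [Fintype 𝒳] [DecidableEq 𝒳] {n : ℕ}

theorem sum_datasetWeight_mul_approxExpect {R : 𝒳 → PMF (List Msg)} {τ : ℝ}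
    (A : FiniteApprox R τ) (x₀ : 𝒳) (c u : I → ℝ) (g : List Msg → ℝ≥0∞) :
    ∑ X : Fin n → 𝒳, datasetWeight x₀ c u X * A.approxExpect X g =
      prodExpect (fun _ : 𝒳 => u) fun l =>
        prodExpect (fun _ z => ∑ x, inputDist x₀ (c ∘ l) x * A.prob x z) fun y : Fin n → _ =>
          (g (List.ofFn fun j => (y j : List Msg)).flatten).toReal := by
  rw [sum_datasetWeight_mul]
  exact congrArg _ (funext fun l => prodExpect_prodExpect _ _ _)

theorem abs_sum_datasetWeight_mul_expect_sub_le {R : 𝒳 → PMF (List Msg)} {x₀ : 𝒳} {K η : ℝ}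
    (hK : 1 ≤ K) (hη0 : 0 < η) (hη : 2 * η < 1) (hR : ∀ x, IsDominated (R x) (R x₀) K η)
    {κ : ℕ} (hκ : 0 < κ) {u v c : I → ℝ} {A ρ : ℝ} (hu : ∀ i, 0 ≤ u i) (hu1 : ∑ i, u i = 1)
    (hv : ∀ i, 0 ≤ v i) (hv1 : ∑ i, v i = 1) (hA : 0 ≤ A) (hc : ∀ i, c i ∈ Set.Icc 0 A)
    (hcard : Fintype.card 𝒳 * A ≤ 1 / 2) (hmoment : ∀ k < κ, ∑ i, (u i - v i) * c i ^ k = 0)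
    (hρ : ρ ≤ 1 / 2) (h : Real.exp 1 * n * (4 * (K + 1) * A ^ 2) ≤ ρ * κ)
    {g : List Msg → ℝ≥0∞} (hg : ∀ l, g l ≤ 1) :
    |∑ X : Fin n → 𝒳, datasetWeight x₀ c u X *
          (expect (concatMessages R (List.ofFn X)) g).toReal -
        ∑ X : Fin n → 𝒳, datasetWeight x₀ c v X *
          (expect (concatMessages R (List.ofFn X)) g).toReal| ≤
      Fintype.card 𝒳 * √(8 * ρ ^ κ) + 4 * n * η := by
  obtain ⟨B, hB_pos, hB_dom⟩ := exists_finiteApprox hK hη0 hη hR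
  have happrox {w : I → ℝ} (hw : ∀ i, 0 ≤ w i) (hw1 : ∑ i, w i = 1) :=
    abs_sum_mul_sub_sum_mul_le (datasetWeight_nonneg hw hc (by linarith) x₀)
      (sum_datasetWeight hw1 x₀ c n) fun X => B.abs_toReal_expect_sub_approxExpect_le hη.le X hg
  have hφ (l : List Msg) : |(g l).toReal| ≤ 1 := by
    rw [abs_of_nonneg ENNReal.toReal_nonneg]
    exact ENNReal.toReal_le_of_le_ofReal zero_le_one (by simpa using hg l)
  have hmixture := abs_prodExpect_mixture_sub_le hκ B.prob_nonneg B.sum_prob hB_pos hB_dom hu hu1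
    hv hv1 hA hc hcard hmoment hρ h
    (φ := fun y => (g (List.ofFn fun j => (y j : List Msg)).flatten).toReal) fun y => hφ _
  rw [← sum_datasetWeight_mul_approxExpect, ← sum_datasetWeight_mul_approxExpect] at hmixture
  have hu_approx := abs_le.1 (happrox hu hu1)
  have hv_approx := abs_le.1 (happrox hv hv1)
  have hmixture := abs_le.1 hmixture
  exact abs_le.2 ⟨by linarith, by linarith⟩

end Indistinguishability

section PublicCoins

open scoped ENNReal

variable {α β ι : Type*}

theorem IsDominated.mono {P Q : PMF α} {K K' η : ℝ} (h : IsDominated P Q K η) (hK : K ≤ K') :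
    IsDominated P Q K' η := fun S =>
  (h S).trans (by gcongr)

theorem toOuterMeasure_bind_map_pair (pub : PMF α) (Q : α → PMF β) (S : Set (α × β)) :
    (pub.bind fun a => (Q a).map fun b => (a, b)).toOuterMeasure S =
      expect pub fun a => (Q a).toOuterMeasure {b | (a, b) ∈ S} := by
  simp only [toOuterMeasure_eq_expect, expect_bind, expect_map]
  rfl

/-- Collect, for every coin on which the domination fails, a set of outcomes that witnesses the
failure. -/
theorem toOuterMeasure_not_isDominated_mul_le {pub : PMF α} {Q Q' : α → PMF β} {K δ : ℝ}
    (h : IsDominated (pub.bind fun a => (Q a).map fun b => (a, b))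
      (pub.bind fun a => (Q' a).map fun b => (a, b)) K δ) (δ' : ℝ) :
    pub.toOuterMeasure {a | ¬ IsDominated (Q a) (Q' a) K δ'} * ENNReal.ofReal δ' ≤
      ENNReal.ofReal δ := by
  classical
  set B : Set α := {a | ¬ IsDominated (Q a) (Q' a) K δ'}
  have hwitness (a : α) : ∃ S : Set β, a ∈ B → ENNReal.ofReal K * (Q' a).toOuterMeasure S +
      ENNReal.ofReal δ' < (Q a).toOuterMeasure S := by
    by_cases ha : a ∈ B
    · obtain ⟨S, hS⟩ := not_forall.1 ha
      exact ⟨S, fun _ => not_le.1 hS⟩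
    · exact ⟨∅, fun h => absurd h ha⟩
  choose S hS using hwitness
  set T : Set (α × β) := {z | z.1 ∈ B ∧ z.2 ∈ S z.1} with hT
  have hle := h T
  rw [toOuterMeasure_bind_map_pair, toOuterMeasure_bind_map_pair] at hle
  have hge : ENNReal.ofReal K * expect pub (fun a => (Q' a).toOuterMeasure {b | (a, b) ∈ T}) +
      pub.toOuterMeasure B * ENNReal.ofReal δ' ≤
        expect pub fun a => (Q a).toOuterMeasure {b | (a, b) ∈ T} := by
    rw [toOuterMeasure_eq_expect, ← expect_mul_left, mul_comm _ (ENNReal.ofReal δ'),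
      ← expect_mul_left, ← expect_add]
    refine expect_mono _ fun a _ => ?_
    by_cases ha : a ∈ B
    · simpa [hT, ha] using (hS a ha).le
    · simp [hT, ha]
  refine (ENNReal.add_le_add_iff_left ?_).1 (hge.trans hle)
  exact ENNReal.mul_ne_top ENNReal.ofReal_ne_top
    (expect_ne_top _ fun a => toOuterMeasure_le_one _ _)

theorem neighboring_cons {𝒳 : Type*} {m : ℕ} (x₀ x : 𝒳) :
    Neighboring (Fin.cons x fun _ : Fin m => x₀ : Fin (m + 1) → 𝒳) fun _ => x₀ := by
  refine ⟨1, 0, fun j hj => ?_⟩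
  obtain ⟨i, rfl⟩ := Fin.exists_succ_eq.2 hj
  rfl

theorem ShuffleProtocol.toOuterMeasure_exists_not_isDominated_mul_le {Coin Msg 𝒳 : Type*}
    [Fintype 𝒳] {P : ShuffleProtocol Coin Msg 𝒳} {m : ℕ} {ε δ : ℝ}
    (h : P.IsShuffleDP (m + 1) ε δ) (x₀ : 𝒳) (δ' : ℝ) :
    P.pub.toOuterMeasure {a | ∃ x, ¬ IsDominated
      (shuffledMessages (P.randomizer a) (Fin.cons x fun _ : Fin m => x₀))
      (shuffledMessages (P.randomizer a) fun _ : Fin (m + 1) => x₀) (Real.exp ε) δ'} *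
        ENNReal.ofReal δ' ≤ Fintype.card 𝒳 * ENNReal.ofReal δ := by
  rw [Set.ofPred_exists]
  refine (mul_le_mul_left (MeasureTheory.measure_iUnion_fintype_le _ _) _).trans ?_
  rw [Finset.sum_mul, ← nsmul_eq_mul]
  exact Finset.sum_le_card_nsmul _ _ _ fun x _ =>
    toOuterMeasure_not_isDominated_mul_le (h _ _ (neighboring_cons x₀ x)) δ'

theorem ofReal_sum_mul_toReal [Fintype ι] {w : ι → ℝ} {f : ι → ℝ≥0∞} (hw : ∀ i, 0 ≤ w i)
    (hf : ∀ i, f i ≠ ∞) :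
    ENNReal.ofReal (∑ i, w i * (f i).toReal) = ∑ i, ENNReal.ofReal (w i) * f i := by
  rw [ENNReal.ofReal_sum_of_nonneg fun i _ => mul_nonneg (hw i) ENNReal.toReal_nonneg]
  exact Finset.sum_congr rfl fun i _ => by
    rw [ENNReal.ofReal_mul (hw i), ENNReal.ofReal_toReal (hf i)]

theorem expect_sum_mul [Fintype ι] (P : PMF α) (c : ι → ℝ≥0∞) (f : ι → α → ℝ≥0∞) :
    (expect P fun a => ∑ i, c i * f i a) = ∑ i, c i * expect P (f i) := by
  simp only [expect, Finset.mul_sum, ← ENNReal.tsum_mul_left, mul_left_comm]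
  exact Summable.tsum_finsetSum fun i _ => ENNReal.summable

theorem ofReal_sum_mul_toReal_expect [Fintype ι] (P : PMF α) {w : ι → ℝ} {f : ι → α → ℝ≥0∞}
    (hw : ∀ i, 0 ≤ w i) (hf : ∀ i a, f i a ≤ 1) :
    ENNReal.ofReal (∑ i, w i * (expect P (f i)).toReal) =
      expect P fun a => ENNReal.ofReal (∑ i, w i * (f i a).toReal) := by
  rw [ofReal_sum_mul_toReal hw fun i => expect_ne_top P (hf i), ← expect_sum_mul]
  exact congrArg _ (funext fun a => (ofReal_sum_mul_toReal hw fun i =>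
    ne_top_of_le_ne_top ENNReal.one_ne_top (hf i a)).symm)

theorem sum_mul_toReal_expect_le [Fintype ι] {P : PMF α} {w w' : ι → ℝ} {f : ι → α → ℝ≥0∞}
    (hw : ∀ i, 0 ≤ w i) (hw1 : ∑ i, w i = 1) (hw' : ∀ i, 0 ≤ w' i) (hf : ∀ i a, f i a ≤ 1)
    {γ ζ : ℝ} (hγ : 0 ≤ γ) (hζ : 0 ≤ ζ) {B : Set α} (hB : P.toOuterMeasure B ≤ ENNReal.ofReal ζ)
    (h : ∀ a ∈ P.support, a ∉ B →
      ∑ i, w i * (f i a).toReal ≤ ∑ i, w' i * (f i a).toReal + γ) :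
    ∑ i, w i * (expect P (f i)).toReal ≤ ∑ i, w' i * (expect P (f i)).toReal + (γ + ζ) := by
  have hnonneg (g : ι → ℝ≥0∞) : 0 ≤ ∑ i, w' i * (g i).toReal :=
    Finset.sum_nonneg fun i _ => mul_nonneg (hw' i) ENNReal.toReal_nonneg
  have hbad (a : α) : ∑ i, w i * (f i a).toReal ≤ 1 := hw1 ▸ Finset.sum_le_sum fun i _ =>
    mul_le_of_le_one_right (hw i)
      (ENNReal.toReal_le_of_le_ofReal zero_le_one (by simpa using hf i a))
  rw [← ENNReal.ofReal_le_ofReal_iff (add_nonneg (hnonneg _) (add_nonneg hγ hζ)),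
    ENNReal.ofReal_add (hnonneg _) (add_nonneg hγ hζ), ENNReal.ofReal_add hγ hζ,
    ofReal_sum_mul_toReal_expect P hw hf, ofReal_sum_mul_toReal_expect P hw' hf]
  calc (expect P fun a => ENNReal.ofReal (∑ i, w i * (f i a).toReal))
      ≤ expect P fun a => ENNReal.ofReal (∑ i, w' i * (f i a).toReal) +
          (ENNReal.ofReal γ + B.indicator 1 a) := by
        refine expect_mono P fun a ha => ?_
        by_cases haB : a ∈ B
        · rw [Set.indicator_of_mem haB, ← add_assoc]
          exact (ENNReal.ofReal_le_one.2 (hbad a)).trans le_add_self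
        · rw [Set.indicator_of_notMem haB, add_zero, ← ENNReal.ofReal_add (hnonneg _) hγ]
          exact ENNReal.ofReal_le_ofReal (h a ha haB)
    _ ≤ _ := by
        rw [expect_add, expect_add, expect_const, ← toOuterMeasure_eq_expect]
        gcongr

theorem ShuffleProtocol.toOuterMeasure_output {Coin Msg 𝒳 : Type*} (P : ShuffleProtocol Coin Msg 𝒳)
    {n : ℕ} (X : Fin n → 𝒳) (S : Set ℝ) :
    (P.output X).toOuterMeasure S = expect P.pub fun a =>
      expect (concatMessages (P.randomizer a) (List.ofFn X)) fun l =>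
        expect (shuffler l) fun l' => (P.analyzer a l').toOuterMeasure S := by
  simp only [toOuterMeasure_eq_expect, ShuffleProtocol.output, ShuffleProtocol.view, expect_bind,
    expect_map]

end PublicCoins

section TestAccuracy

variable {Coin Msg : Type*} {D n : ℕ} {P : ShuffleProtocol Coin Msg (Fin D)} {e : ℝ}

namespace ShuffleProtocol.SolvesCountDistinct

theorem le_toReal_output (h : P.SolvesCountDistinct n e) {X : Fin n → Fin D} {S : Set ℝ}
    (hS : ∀ z : ℝ, |z - countDistinct X| ≤ e → z ∈ S) :
    0.99 ≤ ((P.output X).toOuterMeasure S).toReal :=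
  (ENNReal.ofReal_le_iff_le_toReal (toOuterMeasure_ne_top _ _)).1
    ((h X).trans (MeasureTheory.measure_mono hS))

theorem toReal_output_le (h : P.SolvesCountDistinct n e) {X : Fin n → Fin D} {S : Set ℝ}
    (hS : ∀ z : ℝ, |z - countDistinct X| ≤ e → z ∉ S) :
    ((P.output X).toOuterMeasure S).toReal ≤ 0.01 := by
  have hcompl := h.le_toReal_output (S := Sᶜ) hS
  have hadd := congrArg ENNReal.toReal (toOuterMeasure_add_compl (P.output X) S)
  rw [ENNReal.toReal_add (toOuterMeasure_ne_top _ _) (toOuterMeasure_ne_top _ _),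
    ENNReal.toReal_one] at hadd
  norm_num at hcompl ⊢
  linarith

theorem le_toReal_output_Iio (h : P.SolvesCountDistinct n e) (hD : 0 < D) (he : e ≤ D / 100)
    (X : Fin n → Fin D) :
    0.99 - 4 / (3 * D) * countDistinct X ≤
      ((P.output X).toOuterMeasure (Set.Iio (4 / 5 * D))).toReal := by
  have hD' : (0 : ℝ) < D := Nat.cast_pos.2 hD
  have hcount : 0 ≤ 4 / (3 * D) * (countDistinct X : ℝ) := by positivity
  rcases le_or_gt (countDistinct X : ℝ) (3 / 4 * D) with hfew | hmany
  · have := h.le_toReal_output (X := X) (S := Set.Iio (4 / 5 * D)) fun z hz => by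
      rw [Set.mem_Iio]
      linarith [(abs_le.1 hz).2]
    linarith
  · have : 1 ≤ 4 / (3 * D) * (countDistinct X : ℝ) := by
      rw [div_mul_eq_mul_div, le_div_iff₀ (by positivity)]
      linarith
    refine le_trans ?_ ENNReal.toReal_nonneg
    norm_num
    linarith

theorem toReal_output_Iio_le (h : P.SolvesCountDistinct n e) (hD : 0 < D) (he : e ≤ D / 100)
    (X : Fin n → Fin D) :
    ((P.output X).toOuterMeasure (Set.Iio (4 / 5 * D))).toReal ≤
      0.01 + 10 / D * (D - countDistinct X) := by
  have hD' : (0 : ℝ) < D := Nat.cast_pos.2 hD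
  have hcount : (countDistinct X : ℝ) ≤ D := by
    exact_mod_cast (Finset.card_le_univ _).trans_eq (Fintype.card_fin D)
  have hdiff : 0 ≤ 10 / D * (D - countDistinct X : ℝ) :=
    mul_nonneg (by positivity) (sub_nonneg.2 hcount)
  rcases le_or_gt (9 / 10 * D : ℝ) (countDistinct X) with hmany | hfew
  · have := h.toReal_output_le (X := X) (S := Set.Iio (4 / 5 * D)) fun z hz => by
      rw [Set.mem_Iio, not_lt]
      linarith [(abs_le.1 hz).1]
    linarith
  · have hone : 1 ≤ 10 / D * (D - countDistinct X : ℝ) := by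
      rw [div_mul_eq_mul_div, le_div_iff₀ hD']
      linarith
    have hle : ((P.output X).toOuterMeasure (Set.Iio (4 / 5 * D))).toReal ≤ 1 :=
      ENNReal.toReal_le_of_le_ofReal zero_le_one (by simpa using toOuterMeasure_le_one _ _)
    linarith

variable {w : (Fin n → Fin D) → ℝ}

theorem le_sum_mul_toReal_output_Iio (h : P.SolvesCountDistinct n e) (hD : 0 < D)
    (he : e ≤ D / 100) (hw : ∀ X, 0 ≤ w X) (hw1 : ∑ X, w X = 1) :
    0.99 - 4 / (3 * D) * ∑ X, w X * countDistinct X ≤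
      ∑ X, w X * ((P.output X).toOuterMeasure (Set.Iio (4 / 5 * D))).toReal :=
  calc 0.99 - 4 / (3 * D) * ∑ X, w X * (countDistinct X : ℝ)
      = ∑ X, w X * (0.99 - 4 / (3 * D) * countDistinct X) := by
        simp only [mul_sub, Finset.sum_sub_distrib, ← Finset.sum_mul, hw1, one_mul,
          Finset.mul_sum, mul_left_comm]
    _ ≤ _ := Finset.sum_le_sum fun X _ =>
        mul_le_mul_of_nonneg_left (h.le_toReal_output_Iio hD he X) (hw X)

theorem sum_mul_toReal_output_Iio_le (h : P.SolvesCountDistinct n e) (hD : 0 < D)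
    (he : e ≤ D / 100) (hw : ∀ X, 0 ≤ w X) (hw1 : ∑ X, w X = 1) :
    ∑ X, w X * ((P.output X).toOuterMeasure (Set.Iio (4 / 5 * D))).toReal ≤
      0.01 + 10 / D * ∑ X, w X * (D - countDistinct X) :=
  calc _ ≤ ∑ X, w X * (0.01 + 10 / D * (D - countDistinct X : ℝ)) := Finset.sum_le_sum fun X _ =>
        mul_le_mul_of_nonneg_left (h.toReal_output_Iio_le hD he X) (hw X)
    _ = _ := by
        simp only [mul_add, Finset.sum_add_distrib, ← Finset.sum_mul, hw1, one_mul,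
          Finset.mul_sum, mul_left_comm]

end ShuffleProtocol.SolvesCountDistinct

end TestAccuracy

section LowerBound

open scoped ENNReal

theorem ShuffleProtocol.sum_datasetWeight_mul_toReal_output_le {Coin Msg 𝒳 I : Type*} [Fintype I]
    [Fintype 𝒳] [DecidableEq 𝒳] {P : ShuffleProtocol Coin Msg 𝒳} (hP : P.SendsAtMost 1)
    {m t : ℕ} {ε δ δ' ζ η C : ℝ} (hDP : P.IsShuffleDP (m + 1) ε δ) (hC : 1 ≤ C)
    (hεC : Real.exp ε ≤ C) (htm : t ≤ m) (hη0 : 0 < η) (hη : 2 * η < 1) (hδ' : 0 < δ')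
    (hδη : 4 * δ' ≤ η) (hδt : 2 * δ' ≤ η * (η / (4 * C * (m + 1) * Real.exp 1)) ^ (t + 1))
    (hζ : 0 ≤ ζ) (hδζ : Fintype.card 𝒳 * δ ≤ ζ * δ') (x₀ : 𝒳)
    {κ : ℕ} (hκ : 0 < κ) {u v c : I → ℝ} {A ρ : ℝ} (hu : ∀ i, 0 ≤ u i) (hu1 : ∑ i, u i = 1)
    (hv : ∀ i, 0 ≤ v i) (hv1 : ∑ i, v i = 1) (hA : 0 ≤ A) (hc : ∀ i, c i ∈ Set.Icc 0 A)
    (hcard : Fintype.card 𝒳 * A ≤ 1 / 2) (hmoment : ∀ k < κ, ∑ i, (u i - v i) * c i ^ k = 0)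
    (hρ : ρ ≤ 1 / 2)
    (h : Real.exp 1 * (m + 1 : ℕ) * (4 * (2 * C * (m + 1) / (t + 1) + 1) * A ^ 2) ≤ ρ * κ)
    (S : Set ℝ) :
    ∑ X : Fin (m + 1) → 𝒳, datasetWeight x₀ c u X * ((P.output X).toOuterMeasure S).toReal ≤
      ∑ X : Fin (m + 1) → 𝒳, datasetWeight x₀ c v X * ((P.output X).toOuterMeasure S).toReal +
        (Fintype.card 𝒳 * √(8 * ρ ^ κ) + 4 * (m + 1 : ℕ) * η + ζ) := by
  have hB := P.toOuterMeasure_exists_not_isDominated_mul_le hDP x₀ δ'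
  set B : Set Coin := {a | ∃ x, ¬ IsDominated
      (shuffledMessages (P.randomizer a) (Fin.cons x fun _ : Fin m => x₀))
      (shuffledMessages (P.randomizer a) fun _ : Fin (m + 1) => x₀) (Real.exp ε) δ'}
  have hBζ : P.pub.toOuterMeasure B ≤ ENNReal.ofReal ζ := by
    refine (ENNReal.mul_le_mul_iff_left (ENNReal.ofReal_pos.2 hδ').ne' ENNReal.ofReal_ne_top).1
      (hB.trans ?_)
    rw [← ENNReal.ofReal_mul hζ, ← ENNReal.ofReal_natCast,
      ← ENNReal.ofReal_mul (Nat.cast_nonneg _)]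
    exact ENNReal.ofReal_le_ofReal hδζ
  have hK : 1 ≤ 2 * C * (m + 1) / (t + 1) := by
    have : (t : ℝ) ≤ m := Nat.cast_le.2 htm
    rw [le_div_iff₀ (by positivity)]
    nlinarith
  have hcard' : Fintype.card 𝒳 * A ≤ 1 := by linarith
  simp only [ShuffleProtocol.toOuterMeasure_output]
  refine sum_mul_toReal_expect_le (datasetWeight_nonneg hu hc hcard' x₀)
    (sum_datasetWeight hu1 x₀ c _) (datasetWeight_nonneg hv hc hcard' x₀)
    (fun X a => expect_le_one _ fun l => expect_le_one _ fun l' => toOuterMeasure_le_one _ _)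
    (by positivity) hζ hBζ fun a ha haB => ?_
  have hdom (x : 𝒳) : IsDominated (P.randomizer a x) (P.randomizer a x₀)
      (2 * C * (m + 1) / (t + 1)) η := by
    refine isDominated_randomizer (hP a ha) hC htm hη0 (by linarith) hδ'.le hδη hδt ?_
    exact (not_not.1 (not_exists.1 haB x)).mono hεC
  have hclose := abs_sum_datasetWeight_mul_expect_sub_le hK hη0 hη hdom hκ hu hu1 hv hv1 hA hc
    hcard hmoment hρ h (g := fun l => expect (shuffler l) fun l' =>
      (P.analyzer a l').toOuterMeasure S)
    fun l => expect_le_one _ fun l' => toOuterMeasure_le_one _ _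
  linarith [(abs_le.1 hclose).2]

end LowerBound

section ParameterRegime

/-- The range of parameters of the lower bound: `n` users, a universe of `D` elements,
`κ + 1` nodes and the event that `T` users send an overly likely message, against protocols whose
privacy parameter `ε` satisfies `exp ε ≤ C`. -/
structure ParameterRegime (C : ℝ) (n D κ T : ℕ) : Prop where
  one_le_C : 1 ≤ C
  mul_C_le_n : 4 * C * Real.exp 1 ≤ n
  log_n_le_κ : Real.log n ≤ κ
  mul_pow_κ_le_n : 16 * D * κ ^ 4 ≤ n
  le_D : 100 ≤ D
  mul_pow_κ_le_T : 768 * Real.exp 5 * C * κ ^ 7 ≤ T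
  T_le_n : T ≤ n

namespace ParameterRegime

variable {C : ℝ} {n D κ T : ℕ}

theorem κ_pos (h : ParameterRegime C n D κ T) : 0 < κ := by
  have hn : (1 : ℝ) < n := by nlinarith [h.one_le_C, h.mul_C_le_n, Real.add_one_le_exp (1 : ℝ)]
  exact Nat.cast_pos.1 ((Real.log_pos hn).trans_le h.log_n_le_κ)

theorem T_pos (h : ParameterRegime C n D κ T) : 0 < T := by
  have hC := h.one_le_C
  have hκ := h.κ_pos
  exact Nat.cast_pos.1 ((by positivity : 0 < 768 * Real.exp 5 * C * κ ^ 7).trans_le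
    h.mul_pow_κ_le_T)

theorem mul_D_le_n (h : ParameterRegime C n D κ T) : 16 * D ≤ n :=
  (Nat.le_mul_of_pos_right _ (pow_pos h.κ_pos 4)).trans h.mul_pow_κ_le_n

theorem le_n (h : ParameterRegime C n D κ T) : 1600 ≤ n := by
  linarith [h.mul_D_le_n, h.le_D]

theorem card_mul_node_le (h : ParameterRegime C n D κ T) : D * (node κ / n) ≤ 1 / 2 := by
  have hn : (0 : ℝ) < n := Nat.cast_pos.2 (by linarith [h.le_n])
  have hD : (16 * D * κ ^ 4 : ℝ) ≤ n := by exact_mod_cast h.mul_pow_κ_le_n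
  rw [node, ← mul_div_assoc, div_le_iff₀ hn]
  linarith

theorem card_mul_inv_pow_le (h : ParameterRegime C n D κ T) :
    400 * D * ((n : ℝ) ^ (8 * T))⁻¹ ≤ (n : ℝ) ^ 2 * ((n : ℝ) ^ (4 + 4 * T))⁻¹ := by
  have hn : (1600 : ℝ) ≤ n := by exact_mod_cast h.le_n
  have hD : (16 * D : ℝ) ≤ n := by exact_mod_cast h.mul_D_le_n
  have hT := h.T_pos
  gcongr
  · nlinarith
  · linarith
  · omega

theorem failure_le (h : ParameterRegime C n D κ T) :
    4 * (100 * D * ((n : ℝ) ^ (8 * T))⁻¹) ≤ 1 / (n : ℝ) ^ 2 := by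
  have hn : (1600 : ℝ) ≤ n := by exact_mod_cast h.le_n
  calc 4 * (100 * D * ((n : ℝ) ^ (8 * T))⁻¹) = 400 * D * ((n : ℝ) ^ (8 * T))⁻¹ := by ring
    _ ≤ (n : ℝ) ^ 2 * ((n : ℝ) ^ (4 + 4 * T))⁻¹ := h.card_mul_inv_pow_le
    _ ≤ (n : ℝ) ^ 2 * ((n : ℝ) ^ 4)⁻¹ := by
        gcongr
        · linarith
        · omega
    _ = 1 / (n : ℝ) ^ 2 := by field_simp

theorem failure_le_pow (h : ParameterRegime C n D κ T) :
    2 * (100 * D * ((n : ℝ) ^ (8 * T))⁻¹) ≤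
      1 / (n : ℝ) ^ 2 * (1 / (n : ℝ) ^ 2 / (4 * C * n * Real.exp 1)) ^ T := by
  have hn : (1600 : ℝ) ≤ n := by exact_mod_cast h.le_n
  have hn0 : (0 : ℝ) < n := by linarith
  have hC := h.one_le_C
  have hDn : 0 ≤ 100 * D * ((n : ℝ) ^ (8 * T))⁻¹ := by positivity
  calc 2 * (100 * D * ((n : ℝ) ^ (8 * T))⁻¹) ≤ 400 * D * ((n : ℝ) ^ (8 * T))⁻¹ := by linarith
    _ ≤ (n : ℝ) ^ 2 * ((n : ℝ) ^ (4 + 4 * T))⁻¹ := h.card_mul_inv_pow_le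
    _ = 1 / (n : ℝ) ^ 2 * (1 / (n : ℝ) ^ 2 / (n * n)) ^ T := by
        rw [show 1 / (n : ℝ) ^ 2 / (n * n) = ((n : ℝ) ^ 4)⁻¹ by field_simp, inv_pow, ← pow_mul,
          pow_add]
        field_simp
    _ ≤ 1 / (n : ℝ) ^ 2 * (1 / (n : ℝ) ^ 2 / (4 * C * n * Real.exp 1)) ^ T := by
        have : 4 * C * n * Real.exp 1 ≤ n * n := by
          linarith [mul_le_mul_of_nonneg_right h.mul_C_le_n hn0.le]
        gcongr

theorem collision_le (h : ParameterRegime C n D κ T) :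
    Real.exp 1 * n * (4 * (2 * C * n / T + 1) * (node κ / n) ^ 2) ≤ Real.exp (-4) * κ := by
  have hn : (0 : ℝ) < n := Nat.cast_pos.2 (by linarith [h.le_n])
  have hT : (0 : ℝ) < T := Nat.cast_pos.2 h.T_pos
  have hC := h.one_le_C
  have hone : 1 ≤ C * n / T := by
    have : (T : ℝ) ≤ n := Nat.cast_le.2 h.T_le_n
    rw [le_div_iff₀ hT]
    nlinarith
  calc Real.exp 1 * n * (4 * (2 * C * n / T + 1) * (node κ / n) ^ 2)
      ≤ Real.exp 1 * n * (4 * (2 * C * n / T + C * n / T) * (node κ / n) ^ 2) := by gcongr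
    _ = Real.exp (-4) * ((768 * Real.exp 5 * C * κ ^ 7) * κ / T) := by
        rw [show (1 : ℝ) = -4 + 5 by norm_num, Real.exp_add, node]
        field_simp
        ring
    _ ≤ Real.exp (-4) * (T * κ / T) := by gcongr; exact h.mul_pow_κ_le_T
    _ = Real.exp (-4) * κ := by rw [mul_div_cancel_left₀ _ hT.ne']

theorem card_mul_sqrt_le (h : ParameterRegime C n D κ T) :
    D * √(8 * Real.exp (-4) ^ κ) ≤ 3 / n := by
  have hn : (0 : ℝ) < n := Nat.cast_pos.2 (by linarith [h.le_n])
  have hexp : Real.exp (-4) ^ κ ≤ ((n : ℝ) ^ 4)⁻¹ := by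
    rw [← Real.exp_nat_mul, ← Real.exp_log (inv_pos.2 (pow_pos hn 4)), Real.exp_le_exp,
      Real.log_inv, Real.log_pow]
    push_cast
    linarith [h.log_n_le_κ]
  calc D * √(8 * Real.exp (-4) ^ κ) ≤ n * √(9 * ((n : ℝ) ^ 4)⁻¹) := by
        gcongr
        · linarith [h.mul_D_le_n]
        · norm_num
    _ = n * √((3 / (n : ℝ) ^ 2) ^ 2) := by
        congr 2
        field_simp
        norm_num
    _ = 3 / n := by
        rw [Real.sqrt_sq (by positivity)]
        field_simp

end ParameterRegime

theorem exp_neg_four_le : Real.exp (-4) ≤ 1 / 2 := by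
  rw [Real.exp_neg]
  exact inv_le_of_inv_le₀ (by norm_num) (by linarith [Real.add_one_le_exp (4 : ℝ)])

theorem exp_neg_eight_le : Real.exp (-8) ≤ 1 / 256 := by
  have h : (2 : ℝ) ^ 8 ≤ Real.exp 1 ^ 8 := by gcongr; exact Real.exp_one_gt_two.le
  rw [← Real.exp_nat_mul] at h
  rw [Real.exp_neg]
  exact inv_le_of_inv_le₀ (by norm_num) (by norm_num at h ⊢; exact h)

end ParameterRegime

section QuantitativeLowerBound

variable {Coin Msg : Type*} {C ε e : ℝ} {n D κ T : ℕ} {P : ShuffleProtocol Coin Msg (Fin D)}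

theorem node_div_mem_Icc (n : ℕ) (i : Fin (κ + 1)) : node i / n ∈ Set.Icc 0 (node κ / n) := by
  have hi : node i ≤ node κ := node_strictMono.monotone (Fin.is_le i)
  exact ⟨div_nonneg (node_nonneg _) (Nat.cast_nonneg n), by gcongr⟩

theorem ParameterRegime.sum_datasetWeight_mul_toReal_output_le (h : ParameterRegime C n D κ T)
    (hP : P.SendsAtMost 1) (hDP : P.IsShuffleDP n ε ((n : ℝ) ^ (8 * T))⁻¹)
    (hε : Real.exp ε ≤ C) (x₀ : Fin D) {u v : Fin (κ + 1) → ℝ} (hu : ∀ i, 0 ≤ u i)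
    (hu1 : ∑ i, u i = 1) (hv : ∀ i, 0 ≤ v i) (hv1 : ∑ i, v i = 1)
    (hmoment : ∀ k < κ, ∑ i, (u i - v i) * node i ^ k = 0) (S : Set ℝ) :
    ∑ X : Fin n → Fin D, datasetWeight x₀ (fun i : Fin (κ + 1) => node i / n) u X *
        ((P.output X).toOuterMeasure S).toReal ≤
      ∑ X : Fin n → Fin D, datasetWeight x₀ (fun i : Fin (κ + 1) => node i / n) v X *
        ((P.output X).toOuterMeasure S).toReal + 1 / 50 := by
  have hn : (1600 : ℝ) ≤ n := by exact_mod_cast h.le_n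
  have hD : (100 : ℝ) ≤ D := by exact_mod_cast h.le_D
  have hmoment' : ∀ k < κ, ∑ i, (u i - v i) * (node i / n) ^ k = 0 := fun k hk => by
    simp only [div_pow, ← mul_div_assoc, ← Finset.sum_div, hmoment k hk, zero_div]
  have herror : D * √(8 * Real.exp (-4) ^ κ) + 4 * n * (1 / (n : ℝ) ^ 2) + 1 / 100 ≤ 1 / 50 :=
    calc _ ≤ 3 / n + 4 * n * (1 / (n : ℝ) ^ 2) + 1 / 100 := by
          gcongr
          exact h.card_mul_sqrt_le
      _ = 7 / n + 1 / 100 := by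
          field_simp
          ring
      _ ≤ 7 / 1600 + 1 / 100 := by gcongr
      _ ≤ 1 / 50 := by norm_num
  have hη : 2 * (1 / (n : ℝ) ^ 2) < 1 := by
    rw [mul_one_div, div_lt_one (by positivity)]
    nlinarith
  obtain ⟨m, rfl⟩ := Nat.exists_eq_add_one.2 (show 0 < n by linarith [h.le_n])
  obtain ⟨t, rfl⟩ := Nat.exists_eq_add_one.2 h.T_pos
  refine (P.sum_datasetWeight_mul_toReal_output_le (κ := κ) (A := node κ / (m + 1 : ℕ))
    (δ' := 100 * D * (((m + 1 : ℕ) : ℝ) ^ (8 * (t + 1)))⁻¹) (ζ := 1 / 100)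
    (ρ := Real.exp (-4)) hP hDP h.one_le_C hε (Nat.le_of_lt_succ h.T_le_n) (by positivity) hη
    (by positivity) h.failure_le (by exact_mod_cast h.failure_le_pow) (by norm_num) ?_ x₀ h.κ_pos
    hu hu1 hv hv1 (div_nonneg (node_nonneg _) (Nat.cast_nonneg _)) (node_div_mem_Icc _) ?_
    hmoment' exp_neg_four_le (by exact_mod_cast h.collision_le) S).trans ?_
  · rw [Fintype.card_fin]
    exact le_of_eq (by ring)
  · rw [Fintype.card_fin]
    exact h.card_mul_node_le
  · rw [Fintype.card_fin]
    gcongr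

theorem ParameterRegime.datasetWeight_nonneg (h : ParameterRegime C n D κ T) (x₀ : Fin D)
    {u : Fin (κ + 1) → ℝ} (hu : ∀ i, 0 ≤ u i) (X : Fin n → Fin D) :
    0 ≤ datasetWeight x₀ (fun i : Fin (κ + 1) => node i / n) u X :=
  _root_.datasetWeight_nonneg hu (node_div_mem_Icc n)
    (by rw [Fintype.card_fin]; linarith [h.card_mul_node_le]) x₀ X

theorem ParameterRegime.le_sum_datasetWeight_mul_toReal_output (h : ParameterRegime C n D κ T)
    (hsolves : P.SolvesCountDistinct n e) (he : e ≤ D / 100) (x₀ : Fin D)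
    {u : Fin (κ + 1) → ℝ} (hu : ∀ i, 0 ≤ u i) (hu1 : ∑ i, u i = 1) (hu0 : 2 / 5 ≤ u 0) :
    17 / 100 ≤ ∑ X : Fin n → Fin D, datasetWeight x₀ (fun i : Fin (κ + 1) => node i / n) u X *
      ((P.output X).toOuterMeasure (Set.Iio (4 / 5 * D))).toReal := by
  have hD : (100 : ℝ) ≤ D := by exact_mod_cast h.le_D
  have hcount := sum_datasetWeight_mul_countDistinct_le (n := n) hu hu1 (node_div_mem_Icc n)
    (h.card_mul_node_le.trans (by norm_num)) (i₀ := 0) (by simp [node]) x₀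
  calc (17 / 100 : ℝ) ≤ 0.99 - 4 / (3 * D) * (1 + D * (1 - 2 / 5)) := by
        rw [le_sub_comm, div_mul_eq_mul_div, div_le_iff₀ (by positivity)]
        norm_num
        linarith
    _ ≤ 0.99 - 4 / (3 * D) * ∑ X : Fin n → Fin D,
          datasetWeight x₀ (fun i : Fin (κ + 1) => node i / n) u X * countDistinct X := by
        gcongr
        exact hcount.trans (by gcongr)
    _ ≤ _ := hsolves.le_sum_mul_toReal_output_Iio (by linarith [h.le_D]) he
        (h.datasetWeight_nonneg x₀ hu) (sum_datasetWeight hu1 x₀ _ n)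

theorem ParameterRegime.sum_datasetWeight_mul_toReal_output_le_of_eq_zero
    (h : ParameterRegime C n D κ T) (hsolves : P.SolvesCountDistinct n e) (he : e ≤ D / 100)
    (x₀ : Fin D) {v : Fin (κ + 1) → ℝ} (hv : ∀ i, 0 ≤ v i) (hv1 : ∑ i, v i = 1) (hv0 : v 0 = 0) :
    ∑ X : Fin n → Fin D, datasetWeight x₀ (fun i : Fin (κ + 1) => node i / n) v X *
      ((P.output X).toOuterMeasure (Set.Iio (4 / 5 * D))).toReal ≤ 1 / 10 := by
  have hD : (0 : ℝ) < D := Nat.cast_pos.2 (by linarith [h.le_D])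
  have hn : (n : ℝ) ≠ 0 := Nat.cast_ne_zero.2 (by linarith [h.le_n])
  have hnode (i : Fin (κ + 1)) (hi : v i ≠ 0) : 8 ≤ n * (node i / n) := by
    have : node 1 ≤ node i := node_strictMono.monotone
      (Nat.one_le_iff_ne_zero.2 fun h0 => hi (by rwa [Fin.ext h0 (b := 0)]))
    rw [mul_div_cancel₀ _ hn]
    simpa [node] using this
  have hcount := sum_datasetWeight_mul_sub_countDistinct_le (n := n) hv hv1 (node_div_mem_Icc n)
    (h.card_mul_node_le.trans (by norm_num)) hnode x₀
  calc _ ≤ 0.01 + 10 / D * ∑ X : Fin n → Fin D,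
          datasetWeight x₀ (fun i : Fin (κ + 1) => node i / n) v X * (D - countDistinct X) :=
        hsolves.sum_mul_toReal_output_Iio_le (by linarith [h.le_D]) he
          (h.datasetWeight_nonneg x₀ hv) (sum_datasetWeight hv1 x₀ _ n)
    _ ≤ 0.01 + 10 / D * (D * (1 / 256)) := by
        gcongr
        exact hcount.trans (by gcongr; exact exp_neg_eight_le)
    _ = 0.01 + 10 / 256 := by field_simp
    _ ≤ 1 / 10 := by norm_num

theorem ParameterRegime.not_solvesCountDistinct (h : ParameterRegime C n D κ T)
    (hP : P.SendsAtMost 1) (hDP : P.IsShuffleDP n ε ((n : ℝ) ^ (8 * T))⁻¹)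
    (hε : Real.exp ε ≤ C) (he : e ≤ D / 100) : ¬ P.SolvesCountDistinct n e := by
  intro hsolves
  let x₀ : Fin D := ⟨0, by linarith [h.le_D]⟩
  obtain ⟨u, v, hu, hv, hu1, hv1, hu0, hv0, hmoment⟩ := exists_moment_matching h.κ_pos
  have hfew := h.le_sum_datasetWeight_mul_toReal_output hsolves he x₀ hu hu1 hu0
  have hmany := h.sum_datasetWeight_mul_toReal_output_le_of_eq_zero hsolves he x₀ hv hv1 hv0
  have hclose := h.sum_datasetWeight_mul_toReal_output_le hP hDP hε x₀ hu hu1 hv hv1 hmoment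
    (Set.Iio (4 / 5 * D))
  linarith

end QuantitativeLowerBound

section Asymptotics

/-- The number of nonzero nodes for `n` users, which exceeds `log n`. -/
noncomputable def nodeCount (n : ℕ) : ℕ := ⌊Real.log n⌋₊ + 1

theorem log_le_nodeCount (n : ℕ) : Real.log n ≤ nodeCount n := by
  rw [nodeCount, Nat.cast_add_one]
  exact (Nat.lt_floor_add_one _).le

theorem nodeCount_pos (n : ℕ) : 0 < nodeCount n := Nat.succ_pos _

theorem nodeCount_isTheta_log :
    (fun n => (nodeCount n : ℝ)) =Θ[atTop] fun n : ℕ => Real.log n := by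
  refine ⟨IsBigO.of_bound 2 ?_, IsBigO.of_bound 1 (Eventually.of_forall fun n => ?_)⟩
  · have hlog : Tendsto (fun n : ℕ => Real.log n) atTop atTop :=
      Real.tendsto_log_atTop.comp tendsto_natCast_atTop_atTop
    filter_upwards [hlog.eventually_ge_atTop 1] with n hn
    rw [Real.norm_natCast, Real.norm_of_nonneg (by linarith), nodeCount, Nat.cast_add_one]
    linarith [Nat.floor_le (zero_le_one.trans hn)]
  · rw [Real.norm_natCast, Real.norm_of_nonneg (Real.log_natCast_nonneg n), one_mul]
    exact log_le_nodeCount n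

theorem eventually_mul_nodeCount_pow_le (c : ℝ) (k : ℕ) :
    ∀ᶠ n : ℕ in atTop, c * (nodeCount n : ℝ) ^ k ≤ n := by
  have hlog : (fun n : ℕ => Real.log n ^ k) =o[atTop] fun n : ℕ => (n : ℝ) :=
    (Real.isLittleO_pow_log_id_atTop (n := k)).comp_tendsto tendsto_natCast_atTop_atTop
  have hcount := ((nodeCount_isTheta_log.pow k).1.trans_isLittleO hlog).const_mul_left c
  filter_upwards [hcount.bound one_pos] with n hn
  rw [one_mul, Real.norm_natCast] at hn
  exact (le_abs_self _).trans hn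

theorem natDiv_isTheta {a b : ℕ → ℕ} (hb : ∀ n, 0 < b n) (hab : ∀ᶠ n in atTop, b n ≤ a n) :
    (fun n => ((a n / b n : ℕ) : ℝ)) =Θ[atTop] fun n => (a n : ℝ) / b n := by
  refine ⟨IsBigO.of_bound 1 (Eventually.of_forall fun n => ?_), IsBigO.of_bound 2 ?_⟩
  · rw [Real.norm_natCast, Real.norm_of_nonneg (by positivity), one_mul]
    exact Nat.cast_div_le
  · filter_upwards [hab] with n hn
    rw [Real.norm_natCast, Real.norm_of_nonneg (by positivity),
      div_le_iff₀ (Nat.cast_pos.2 (hb n))]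
    have hquot : 1 ≤ a n / b n := (Nat.one_le_div_iff (hb n)).2 hn
    have hlt : a n < b n * (a n / b n + 1) := Nat.lt_mul_div_succ _ (hb n)
    exact_mod_cast show a n ≤ 2 * (a n / b n) * b n by nlinarith

/-- The size of the universe for `n` users. -/
noncomputable def universeSize (n : ℕ) : ℕ := n / (16 * nodeCount n ^ 4)

theorem universeSize_isTheta :
    (fun n => (universeSize n : ℝ)) =Θ[atTop] fun n : ℕ => (n : ℝ) / Real.log n ^ 4 := by
  have hdiv := natDiv_isTheta (a := id) (b := fun n => 16 * nodeCount n ^ 4)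
    (fun n => mul_pos (by norm_num) (pow_pos (nodeCount_pos n) 4))
    ((eventually_mul_nodeCount_pow_le 16 4).mono fun n hn => by exact_mod_cast hn)
  push_cast at hdiv
  exact hdiv.trans ((isTheta_refl _ _).div
    ((nodeCount_isTheta_log.pow 4).const_mul_left (by norm_num)))

/-- The number of users sending an overly likely message that reveals a change of one input. -/
noncomputable def testThreshold (C : ℝ) (n : ℕ) : ℕ :=
  ⌈768 * Real.exp 5 * C⌉₊ * nodeCount n ^ 7

/-- The privacy parameter `δ` for `n` users, which is `n ^ (-8 * testThreshold C n)` for `0 < n` and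
`1` for `n = 0`. -/
noncomputable def privacyDelta (C : ℝ) (n : ℕ) : ℝ :=
  Real.exp (-(8 * testThreshold C n * Real.log n))

theorem privacyDelta_pos (C : ℝ) (n : ℕ) : 0 < privacyDelta C n := Real.exp_pos _

theorem privacyDelta_le_one (C : ℝ) (n : ℕ) : privacyDelta C n ≤ 1 :=
  Real.exp_le_one_iff.2 (neg_nonpos.2 (mul_nonneg (by positivity) (Real.log_natCast_nonneg n)))

theorem privacyDelta_eq_inv_pow (C : ℝ) {n : ℕ} (hn : 0 < n) :
    privacyDelta C n = ((n : ℝ) ^ (8 * testThreshold C n))⁻¹ := by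
  rw [privacyDelta, Real.exp_neg, ← Real.exp_log (pow_pos (Nat.cast_pos.2 hn : (0 : ℝ) < n) _),
    Real.log_pow]
  push_cast
  rfl

theorem neg_logb_privacyDelta_isTheta {C : ℝ} (hC : 0 < C) :
    (fun n => -Real.logb 2 (privacyDelta C n)) =Θ[atTop] fun n : ℕ => Real.log n ^ 8 := by
  have heq : (fun n => -Real.logb 2 (privacyDelta C n)) = fun n : ℕ =>
      (8 * (⌈768 * Real.exp 5 * C⌉₊ : ℝ) / Real.log 2) * ((nodeCount n : ℝ) ^ 7 * Real.log n) := by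
    funext n
    rw [privacyDelta, Real.logb, Real.log_exp, testThreshold]
    push_cast
    ring
  have : 0 < ⌈768 * Real.exp 5 * C⌉₊ := Nat.ceil_pos.2 (by positivity)
  have : 0 < Real.log 2 := Real.log_pos one_lt_two
  simp only [heq, pow_succ _ 7]
  exact IsTheta.const_mul_left (by positivity)
    ((nodeCount_isTheta_log.pow 7).mul (isTheta_refl _ _))

theorem eventually_parameterRegime {C : ℝ} (hC : 1 ≤ C) :
    ∀ᶠ n in atTop,
      ParameterRegime C n (universeSize n) (nodeCount n) (testThreshold C n) := by
  filter_upwards [eventually_mul_nodeCount_pow_le 1600 4,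
    eventually_mul_nodeCount_pow_le (⌈768 * Real.exp 5 * C⌉₊ : ℝ) 7,
    tendsto_natCast_atTop_atTop.eventually_ge_atTop (4 * C * Real.exp 1)] with n hD hT hn
  refine ⟨hC, hn, log_le_nodeCount n, ?_, ?_, ?_, by exact_mod_cast hT⟩
  · rw [mul_right_comm, mul_comm]
    exact Nat.div_mul_le_self _ _
  · rw [universeSize, Nat.le_div_iff_mul_le (mul_pos (by norm_num) (pow_pos (nodeCount_pos n) 4)),
      ← mul_assoc]
    exact_mod_cast hD
  · rw [testThreshold]
    push_cast
    gcongr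
    exact Nat.le_ceil _

end Asymptotics

theorem theorem4 (ε : ℕ → ℝ) (hε_nonneg : ∀ n, 0 ≤ ε n)
    (hε : ε =O[atTop] fun _ => (1 : ℝ)) :
    ∃ (δ : ℕ → ℝ) (D : ℕ → ℕ),
      (∀ n, 0 < δ n ∧ δ n ≤ 1) ∧
      (fun n => -Real.logb 2 (δ n)) =Θ[atTop] (fun n : ℕ => Real.log n ^ 8) ∧
      (fun n => (D n : ℝ)) =Θ[atTop] (fun n : ℕ => (n : ℝ) / Real.log n ^ 4) ∧
      ∀ e : ℕ → ℝ, e =o[atTop] (fun n => (D n : ℝ)) →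
        ∀ᶠ n in atTop, ∀ (Coin Msg : Type*) (P : ShuffleProtocol Coin Msg (Fin (D n))),
          P.SendsAtMost 1 → P.IsShuffleDP n (ε n) (δ n) →
            ¬ P.SolvesCountDistinct n (e n) := by
  obtain ⟨M, hM⟩ := hε.bound
  set C := Real.exp (max M 0)
  have hC : 1 ≤ C := Real.one_le_exp (le_max_right _ _)
  refine ⟨privacyDelta C, universeSize, fun n => ⟨privacyDelta_pos C n, privacyDelta_le_one C n⟩,
    neg_logb_privacyDelta_isTheta (by positivity), universeSize_isTheta, fun e he => ?_⟩
  filter_upwards [hM, he.bound (show (0 : ℝ) < 1 / 100 by norm_num), eventually_parameterRegime hC]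
    with n hεn hen hregime Coin Msg P hP hDP
  rw [norm_one, mul_one, Real.norm_of_nonneg (hε_nonneg n)] at hεn
  rw [Real.norm_natCast, one_div_mul_eq_div] at hen
  rw [privacyDelta_eq_inv_pow C (by linarith [hregime.le_n])] at hDP
  exact hregime.not_solvesCountDistinct hP hDP (Real.exp_le_exp.2 (le_max_of_le_left hεn))
    ((le_abs_self _).trans hen)
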